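/- Let $f(\cdot\,;\theta)$, $\theta\ge 0$, be a family of positive probability densities on $\mathbb{R}$ with $f(x;0)=\phi(x)=(2\pi)^{-1/2}e^{-x^2/2}$, such that for every $x$ the function $\theta\mapsto\log f(x;\theta)$ is continuously differentiable on $[0,\infty)$ (boundary $\theta=0$ included). Put $f_{a,b}(x;\theta)=\frac1b f\left(\frac{x-a}{b};\theta\right)$ for $a\in\mathbb{R}$, $b>0$, and let $l_\theta(x;0)=\frac{\partial}{\partial\theta}\log f(x;\theta)\big|_{\theta=0}$ be the score function at $\theta=0$. Fix a sample size $n\ge 2$ and assume that for some $\epsilon>0$ $$\int_0^\infty\int_{-\infty}^\infty g(a,b;\epsilon)^n\exp\Big(-\frac{n(a^2+b^2)}2\Big)b^{n-2}\,da\,db<\infty,\qquad g(a,b;\epsilon)=\sup_{|z|\le\sqrt n,\;0\le\theta\le\epsilon}\frac{\left|\frac{\partial}{\partial\theta}f(a+bz;\theta)\right|}{f(a+bz;0)}.$$ On the basis of i.i.d. observations $x_1,\dots,x_n$ from $f_{a,b}(\cdot\,;\theta)$, with $a,b$ unknown, consider testing $H_0:\theta=0$ against $H_1:\theta>0$ by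 (possibly randomized) tests that are invariant under $x_i\mapsto a+bx_i$, $a\in\mathbb{R}$, $b>0$. An invariant test of level $\alpha$ is locally best invariant (LBI) at level $\alpha$ if for every invariant test of level $\alpha$ there is $\delta>0$ such that its power is at least that of the other test at all $\theta\in(0,\delta)$, for all $a\in\mathbb{R}$ and $b>0$. Let $P_0$ denote the distribution of the sample under the standard normal distribution. Say that the LBI test is given by a statistic $S$ if, for every real $k$ with $P_0(S=k)=0$, the rejection region $\{S>k\}$ is LBI at level $P_0(S>k)$, and every LBI test at that level is $P_0$-almost surely equal to the indicator of $\{S>k\}$. Let $\tilde m_l=m_l/s^l$, where $\bar x=\frac1n\sum_i x_i$, $m_l=\frac1n\sum_i(x_i-\bar x)^l$ and $s=\sqrt{m_2}$. (i) Suppose $l_\theta(x;0)$ is a polynomial in $x$ of degree $3$ with leading coefficient $c$. Then the LBI test is given by the standardized sample skewness $\tilde m_3$ if $c>0$, and by $-\tilde m_3$ if $c<0$. If moreover $n\ge3$, then $P_0(\tilde m_3=k)=0$ for every real $k$, and every size $\alpha\in(0,1)$ is attained by some region $\{\tilde m_3>k\}$ if $c>0$ and by some region $\{-\tilde m_3>k\}$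 if $c<0$. (ii) Suppose $l_\theta(x;0)$ is a polynomial in $x$ of degree $4$ without odd-degree terms, with leading coefficient $c$. Then the LBI test is given by the standardized sample kurtosis $\tilde m_4$ if $c>0$, and by $-\tilde m_4$ if $c<0$. If moreover $n\ge4$, then $P_0(\tilde m_4=k)=0$ for every real $k$, and every size $\alpha\in(0,1)$ is attained by some region $\{\tilde m_4>k\}$ if $c>0$ and by some region $\{-\tilde m_4>k\}$ if $c<0$. -/

import Mathlib

open MeasureTheory ProbabilityTheory

noncomputable section

/-- A one-parameter family of standard members `f θ : ℝ → ℝ`, `θ ≥ 0`, of location-scale densities: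
each `f θ` is a (positive) probability density, `f 0` is the standard normal density, and
`log f θ x` is continuously differentiable in `θ ∈ [0, ∞)`, the boundary point `0` included. -/
structure IsShapeFamily (f : ℝ → ℝ → ℝ) : Prop where
  measurable : ∀ θ, 0 ≤ θ → Measurable (f θ)
  pos : ∀ θ, 0 ≤ θ → ∀ x, 0 < f θ x
  integral_eq_one : ∀ θ, 0 ≤ θ → ∫ x, f θ x = 1
  normal_at_zero : ∀ x, f 0 x = gaussianPDFReal 0 1 x
  contDiff_log : ∀ x, ContDiffOn ℝ 1 (fun θ => Real.log (f θ x)) (Set.Ici 0)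

/-- The density `f_{a,b}(x; θ) = (1 / b) f((x - a) / b; θ)`. -/
def locScaleDensity (f : ℝ → ℝ → ℝ) (a b θ x : ℝ) : ℝ :=
  1 / b * f θ ((x - a) / b)

/-- The joint law of `n` i.i.d. observations from `f_{a,b}(· ; θ)`. -/
def sampleLaw (f : ℝ → ℝ → ℝ) (n : ℕ) (a b θ : ℝ) : Measure (Fin n → ℝ) :=
  Measure.pi fun _ => volume.withDensity fun x => ENNReal.ofReal (locScaleDensity f a b θ x)

/-- The score function at normality: the (one-sided) derivative of `log f θ x` in `θ` at `0`. -/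
def scoreAtNormal (f : ℝ → ℝ → ℝ) (x : ℝ) : ℝ :=
  derivWithin (fun θ => Real.log (f θ x)) (Set.Ici 0) 0

/-- `g(a, b; ε)`, the supremum over `|z| ≤ √n` and `0 ≤ θ ≤ ε` of
`|∂f/∂θ (a + b z; θ)| / f(a + b z; 0)`, with values in `[0, ∞]`. -/
def scoreEnvelope (f : ℝ → ℝ → ℝ) (n : ℕ) (ε a b : ℝ) : ENNReal :=
  ⨆ z ∈ Set.Icc (-√(n : ℝ)) (√(n : ℝ)), ⨆ θ ∈ Set.Icc (0 : ℝ) ε,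
    ENNReal.ofReal (|derivWithin (fun t => f t (a + b * z)) (Set.Ici 0) θ| / f 0 (a + b * z))

/-- The regularity condition: for some `ε > 0`,
`∫₀^∞ ∫ g(a, b; ε)^n exp(-n (a² + b²) / 2) b^(n-2) da db < ∞`. -/
def RegularityCondition (f : ℝ → ℝ → ℝ) (n : ℕ) : Prop :=
  ∃ ε : ℝ, 0 < ε ∧
    (∫⁻ b in Set.Ioi (0 : ℝ), ∫⁻ a : ℝ, scoreEnvelope f n ε a b ^ n *
      ENNReal.ofReal (Real.exp (-(n * (a ^ 2 + b ^ 2) / 2)) * b ^ (n - 2))) < ⊤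

/-- Invariant (possibly randomized) tests: measurable functions with values in `[0, 1]`, invariant
under `x ↦ a + b x` for all real `a` and all `b > 0`. A critical region is identified with its
indicator function. -/
structure IsInvariantTest {n : ℕ} (φ : (Fin n → ℝ) → ℝ) : Prop where
  measurable : Measurable φ
  mem_Icc : ∀ x, φ x ∈ Set.Icc (0 : ℝ) 1
  invariant : ∀ (a b : ℝ), 0 < b → ∀ x, φ (fun i => a + b * x i) = φ x

/-- The probability that the test `φ` rejects when the observations come from `f_{a,b}(· ; θ)`. -/
def testPower (f : ℝ → ℝ → ℝ) {n : ℕ} (φ : (Fin n → ℝ) → ℝ) (a b θ : ℝ) : ℝ :=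
  ∫ x, φ x ∂(sampleLaw f n a b θ)

/-- `φ` has level `α` for the null hypothesis of normality (`θ = 0`, any location and scale). -/
def HasLevel (f : ℝ → ℝ → ℝ) {n : ℕ} (α : ℝ) (φ : (Fin n → ℝ) → ℝ) : Prop :=
  ∀ a b : ℝ, 0 < b → testPower f φ a b 0 ≤ α

/-- `φ` is a locally best invariant test of level `α` of `θ = 0` against `θ > 0`: it is an invariant
test of level `α`, and for every invariant test `ψ` of level `α` its power is at least that of `ψ`
at all sufficiently small `θ > 0`. -/
def IsLBITest (f : ℝ → ℝ → ℝ) {n : ℕ} (α : ℝ) (φ : (Fin n → ℝ) → ℝ) : Prop :=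
  IsInvariantTest φ ∧ HasLevel f α φ ∧
    ∀ ψ : (Fin n → ℝ) → ℝ, IsInvariantTest ψ → HasLevel f α ψ →
      ∃ δ : ℝ, 0 < δ ∧ ∀ θ ∈ Set.Ioo 0 δ, ∀ a b : ℝ, 0 < b →
        testPower f ψ a b θ ≤ testPower f φ a b θ

/-- The law of the sample under the standard normal null distribution. -/
def nullLaw (f : ℝ → ℝ → ℝ) (n : ℕ) : Measure (Fin n → ℝ) := sampleLaw f n 0 1 0

/-- The region `R` is, up to null sets, the unique locally best invariant critical region at its
own size. -/
def IsUniqueLBIRegion (f : ℝ → ℝ → ℝ) {n : ℕ} (R : Set (Fin n → ℝ)) : Prop :=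
  IsLBITest f ((nullLaw f n).real R) (R.indicator 1) ∧
    ∀ ψ : (Fin n → ℝ) → ℝ, IsLBITest f ((nullLaw f n).real R) ψ →
      ψ =ᵐ[nullLaw f n] R.indicator 1

/-- The locally best invariant test is given by the statistic `S`: each region `S > k` is the
unique locally best invariant region of its size, provided `P₀(S = k) = 0`. -/
def LBITestGivenBy (f : ℝ → ℝ → ℝ) {n : ℕ} (S : (Fin n → ℝ) → ℝ) : Prop :=
  ∀ k : ℝ, nullLaw f n {x | S x = k} = 0 → IsUniqueLBIRegion f {x | k < S x}

/-- Under normality no value of `S` has positive probability, and every size in `(0, 1)` is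
attained by some region `S > k`. -/
def HasAllCriticalValues (f : ℝ → ℝ → ℝ) {n : ℕ} (S : (Fin n → ℝ) → ℝ) : Prop :=
  (∀ k : ℝ, nullLaw f n {x | S x = k} = 0) ∧
    ∀ α ∈ Set.Ioo (0 : ℝ) 1, ∃ k : ℝ, (nullLaw f n).real {x | k < S x} = α

/-- The sample mean. -/
def sampleMean {n : ℕ} (x : Fin n → ℝ) : ℝ := (1 / n) * ∑ i, x i

/-- The `l`-th central sample moment `m_l`. -/
def sampleCentralMoment {n : ℕ} (l : ℕ) (x : Fin n → ℝ) : ℝ :=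
  (1 / n) * ∑ i, (x i - sampleMean x) ^ l

/-- The sample standard deviation `s` (with divisor `n`). -/
def sampleSD {n : ℕ} (x : Fin n → ℝ) : ℝ := √(sampleCentralMoment 2 x)

/-- The standardized sample skewness `m₃ / s³`. -/
def sampleSkewness {n : ℕ} (x : Fin n → ℝ) : ℝ := sampleCentralMoment 3 x / sampleSD x ^ 3

/-- The standardized sample kurtosis `m₄ / s⁴`. -/
def sampleKurtosis {n : ℕ} (x : Fin n → ℝ) : ℝ := sampleCentralMoment 4 x / sampleSD x ^ 4

end

/-! ### Changes of variables -/

/-! An invariant test is constant on the orbits of the affine group, so its power depends only on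
the likelihood integrated along each orbit. With `z` the standardized sample of `y`, points of the
orbit are `a + b z`, and `lintegral_gaussian_orbitIntegral` (a form of Wijsman's theorem) says that
drawing `y` from the normal law and integrating over `(a, b)` with weight `b ^ (n - 2)` gives
Lebesgue measure up to a constant `K`. Hence `K` times the power is an integral of `φ y * ∏ f θ (a +
b zᵢ) * b ^ (n - 2)`.

The regularity condition permits differentiation in `θ` at `0` under this integral
(`tendsto_testPower_slope`). Since `∑ zᵢ = 0` and `∑ zᵢ ^ 2 = n`, the normal likelihood at `a + b z`
depends on `(a, b)` only, so `z` enters the derivative only through the sum of scores. For a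
polynomial score that sum is a polynomial in `(a, b)` whose coefficients involve `z` only through
its power sums, that is, the standardized moments. In degree 3 only the skewness appears. In the
even degree 4 case the skewness carries a factor odd in `a` and integrates to zero, leaving the
kurtosis. In both cases the slope of the power is `A * E φ + B * E (φ S)` with `B > 0`, where `S` is
the statistic with the sign of the leading coefficient.

Local optimality and uniqueness are then the Neyman–Pearson argument applied to `S`
(`lbiTestGivenBy_of_slope`). That the statistics have no atoms follows because `S = k` forces a
nontrivial polynomial relation in the sample, and every size is attained because the distribution
function is then continuous. -/

theorem lintegral_eq_mul_lintegral_affine {s : ℝ} (hs : 0 < s) (a : ℝ) {F : ℝ → ENNReal}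
    (hF : Measurable F) : ∫⁻ x, F x = ENNReal.ofReal s * ∫⁻ x, F (a + s * x) := by
  have h1 : ∫⁻ x, F x = ∫⁻ x, F (a + x) := (lintegral_add_left_eq_self F a).symm
  have hF' : Measurable fun x => F (a + x) := hF.comp (measurable_const_add a)
  rw [h1]
  conv_lhs => rw [← Real.smul_map_volume_mul_left hs.ne']
  rw [lintegral_smul_measure, lintegral_map hF' (measurable_const_mul s), abs_of_pos hs, smul_eq_mul]

theorem setLIntegral_Ioi_eq_mul_scale {s : ℝ} (hs : 0 < s) {F : ℝ → ENNReal} (hF : Measurable F) :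
    ∫⁻ x in Set.Ioi 0, F x = ENNReal.ofReal s * ∫⁻ x in Set.Ioi 0, F (s * x) := by
  rw [← lintegral_indicator measurableSet_Ioi, ← lintegral_indicator measurableSet_Ioi,
    lintegral_eq_mul_lintegral_affine hs 0 (hF.indicator measurableSet_Ioi)]
  congr 1
  refine lintegral_congr fun x => ?_
  simp only [Set.indicator, Set.mem_Ioi, zero_add, mul_pos_iff_of_pos_left hs]

theorem lintegral_pi_eq_mul_lintegral_affine {n : ℕ} {s : ℝ} (hs : 0 < s) (a : ℝ)
    {F : (Fin n → ℝ) → ENNReal} (hF : Measurable F) :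
    ∫⁻ x, F x = ENNReal.ofReal (s ^ n) * ∫⁻ x : Fin n → ℝ, F (fun i => a + s * x i) := by
  have h1 : ∫⁻ x, F x = ∫⁻ x, F ((fun _ => a) + x) := (lintegral_add_left_eq_self F _).symm
  have hF' : Measurable fun x => F ((fun _ => a) + x) := hF.comp (measurable_const_add _)
  have h2 : ∫⁻ x : Fin n → ℝ, F (fun i => a + s * x i)
      = ENNReal.ofReal (|(s ^ n)⁻¹|) * ∫⁻ x, F ((fun _ => a) + x) := by
    have := lintegral_map (μ := volume) hF' (measurable_const_smul (α := Fin n → ℝ) s)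
    rw [Measure.map_addHaar_smul _ hs.ne', lintegral_smul_measure, Module.finrank_fin_fun] at this
    exact this.symm
  rw [h2, h1, ← mul_assoc, ← ENNReal.ofReal_mul (by positivity), abs_of_pos (by positivity),
    mul_inv_cancel₀ (by positivity), ENNReal.ofReal_one, one_mul]

/-! ### The law of the sample -/

theorem withDensity_locScale {g : ℝ → ℝ} (hg : Measurable g) (a : ℝ) {b : ℝ} (hb : 0 < b) :
    (volume.withDensity fun x => ENNReal.ofReal (1 / b * g ((x - a) / b))) =
      (volume.withDensity fun x => ENNReal.ofReal (g x)).map (fun x => a + b * x) := by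
  ext s hs
  have hm : Measurable fun x : ℝ => a + b * x := by fun_prop
  rw [Measure.map_apply hm hs, withDensity_apply _ hs, withDensity_apply _ (hm hs),
    ← lintegral_indicator hs, ← lintegral_indicator (hm hs)]
  rw [lintegral_eq_mul_lintegral_affine hb a (Measurable.indicator (by fun_prop) hs),
    ← lintegral_const_mul _ (by exact (Measurable.indicator (by fun_prop) hs).comp hm)]
  refine lintegral_congr fun x => ?_
  by_cases h : a + b * x ∈ s
  · rw [Set.indicator_of_mem h, Set.indicator_of_mem (by exact h), ← ENNReal.ofReal_mul hb.le]
    congr 1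
    rw [add_sub_cancel_left, mul_div_cancel_left₀ _ hb.ne']
    field_simp
  · rw [Set.indicator_of_notMem h, Set.indicator_of_notMem (by exact h), mul_zero]

theorem pi_withDensity_ofReal {n : ℕ} {g : ℝ → ℝ} (hg : Integrable g) (hg0 : ∀ x, 0 ≤ g x) :
    Measure.pi (fun _ : Fin n => volume.withDensity fun x => ENNReal.ofReal (g x)) =
      volume.withDensity fun x : Fin n → ℝ => ENNReal.ofReal (∏ i, g (x i)) := by
  refine Measure.pi_eq fun s hs => ?_
  rw [withDensity_apply _ (MeasurableSet.univ_pi hs), volume_pi, Measure.restrict_pi_pi]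
  simp_rw [fun i => withDensity_apply (μ := volume) (fun x => ENNReal.ofReal (g x)) (hs i)]
  rw [← ofReal_integral_eq_lintegral_ofReal (Integrable.fintype_prod fun i => hg.restrict)
    (Filter.Eventually.of_forall fun x => Finset.prod_nonneg fun i _ => hg0 _),
    integral_fintype_prod_eq_prod (fun _ => g),
    ENNReal.ofReal_prod_of_nonneg fun i _ => integral_nonneg fun x => hg0 x]
  refine Finset.prod_congr rfl fun i _ => ?_
  rw [ofReal_integral_eq_lintegral_ofReal hg.restrict (Filter.Eventually.of_forall hg0)]

namespace IsShapeFamily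

variable {f : ℝ → ℝ → ℝ} {θ : ℝ} {n : ℕ}

theorem integrable (hf : IsShapeFamily f) (hθ : 0 ≤ θ) : Integrable (f θ) := by
  by_contra h
  have := hf.integral_eq_one θ hθ
  rw [integral_undef h] at this
  exact zero_ne_one this

theorem isProbabilityMeasure_withDensity (hf : IsShapeFamily f) (hθ : 0 ≤ θ) :
    IsProbabilityMeasure (volume.withDensity fun x => ENNReal.ofReal (f θ x)) := by
  constructor
  rw [withDensity_apply _ MeasurableSet.univ, Measure.restrict_univ,
    ← ofReal_integral_eq_lintegral_ofReal (hf.integrable hθ)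
      (Filter.Eventually.of_forall fun x => (hf.pos θ hθ x).le),
    hf.integral_eq_one θ hθ, ENNReal.ofReal_one]

theorem sampleLaw_eq_map (hf : IsShapeFamily f) (hθ : 0 ≤ θ) (a : ℝ) {b : ℝ} (hb : 0 < b) :
    sampleLaw f n a b θ = (sampleLaw f n 0 1 θ).map (fun x i => a + b * x i) := by
  have := hf.isProbabilityMeasure_withDensity hθ
  have hm : Measurable fun x : ℝ => a + b * x := by fun_prop
  have hp : IsProbabilityMeasure ((volume.withDensity fun x => ENNReal.ofReal (f θ x)).map
    fun x => a + b * x) := Measure.isProbabilityMeasure_map hm.aemeasurable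
  simp only [sampleLaw, locScaleDensity, withDensity_locScale (hf.measurable θ hθ) a hb]
  simp only [sub_zero, div_one, one_mul]
  rw [Measure.pi_map_pi fun i => hm.aemeasurable]

theorem sampleLaw_zero_one (hf : IsShapeFamily f) (hθ : 0 ≤ θ) :
    sampleLaw f n 0 1 θ =
      volume.withDensity fun x : Fin n → ℝ => ENNReal.ofReal (∏ i, f θ (x i)) := by
  rw [← pi_withDensity_ofReal (hf.integrable hθ) (fun x => (hf.pos θ hθ x).le)]
  simp [sampleLaw, locScaleDensity]

theorem isProbabilityMeasure_sampleLaw (hf : IsShapeFamily f) (hθ : 0 ≤ θ) :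
    IsProbabilityMeasure (sampleLaw f n 0 1 θ) := by
  have := hf.isProbabilityMeasure_withDensity hθ
  simp only [sampleLaw, locScaleDensity, sub_zero, div_one, one_mul]
  infer_instance

theorem testPower_eq (hf : IsShapeFamily f) (hθ : 0 ≤ θ) (a : ℝ) {b : ℝ} (hb : 0 < b)
    {φ : (Fin n → ℝ) → ℝ} (hφ : IsInvariantTest φ) :
    testPower f φ a b θ = testPower f φ 0 1 θ := by
  rw [testPower, hf.sampleLaw_eq_map hθ a hb,
    integral_map (Measurable.aemeasurable (by fun_prop))
       hφ.measurable.aestronglyMeasurable]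
  simp only [hφ.invariant a b hb, testPower]

end IsShapeFamily

/-! ### Standardized samples -/

theorem sampleMean_affine {n : ℕ} (hn : n ≠ 0) (a b : ℝ) (x : Fin n → ℝ) :
    sampleMean (fun i => a + b * x i) = a + b * sampleMean x := by
  have : (n : ℝ) ≠ 0 := Nat.cast_ne_zero.2 hn
  simp only [sampleMean, Finset.sum_add_distrib, ← Finset.mul_sum, Finset.sum_const,
    Finset.card_univ, Fintype.card_fin, nsmul_eq_mul]
  field_simp

theorem sampleCentralMoment_affine {n : ℕ} (hn : n ≠ 0) (l : ℕ) (a b : ℝ) (x : Fin n → ℝ) :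
    sampleCentralMoment l (fun i => a + b * x i) = b ^ l * sampleCentralMoment l x := by
  simp only [sampleCentralMoment, sampleMean_affine hn, add_sub_add_left_eq_sub, ← mul_sub, mul_pow,
    ← Finset.mul_sum]
  ring

theorem sampleCentralMoment_two_nonneg {n : ℕ} (x : Fin n → ℝ) : 0 ≤ sampleCentralMoment 2 x :=
  mul_nonneg (by positivity) (Finset.sum_nonneg fun i _ => sq_nonneg _)

theorem sampleSD_affine {n : ℕ} (hn : n ≠ 0) (a : ℝ) {b : ℝ} (hb : 0 < b) (x : Fin n → ℝ) :
    sampleSD (fun i => a + b * x i) = b * sampleSD x := by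
  rw [sampleSD, sampleCentralMoment_affine hn, Real.sqrt_mul (sq_nonneg b), Real.sqrt_sq hb.le,
    sampleSD]

theorem sampleSD_sq {n : ℕ} (x : Fin n → ℝ) : sampleSD x ^ 2 = sampleCentralMoment 2 x :=
  Real.sq_sqrt (sampleCentralMoment_two_nonneg x)

theorem sampleSD_nonneg {n : ℕ} (x : Fin n → ℝ) : 0 ≤ sampleSD x := Real.sqrt_nonneg _

theorem measurable_sampleMean {n : ℕ} : Measurable (sampleMean (n := n)) := by
  unfold sampleMean; fun_prop

theorem measurable_sampleCentralMoment {n : ℕ} (l : ℕ) :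
    Measurable (sampleCentralMoment (n := n) l) := by
  have := measurable_sampleMean (n := n)
  unfold sampleCentralMoment; fun_prop

theorem measurable_sampleSD {n : ℕ} : Measurable (sampleSD (n := n)) :=
  (measurable_sampleCentralMoment 2).sqrt

/-- The standardized sample. -/
noncomputable def standardize {n : ℕ} (x : Fin n → ℝ) (i : Fin n) : ℝ :=
  (x i - sampleMean x) / sampleSD x

theorem measurable_standardize {n : ℕ} (i : Fin n) :
    Measurable fun x : Fin n → ℝ => standardize x i :=
  ((measurable_pi_apply i).sub measurable_sampleMean).div measurable_sampleSD

theorem sum_standardize {n : ℕ} (hn : n ≠ 0) (x : Fin n → ℝ) : ∑ i, standardize x i = 0 := by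
  have : (n : ℝ) ≠ 0 := Nat.cast_ne_zero.2 hn
  simp only [standardize, ← Finset.sum_div, Finset.sum_sub_distrib, Finset.sum_const,
    Finset.card_univ, Fintype.card_fin, nsmul_eq_mul, sampleMean]
  field_simp
  simp

theorem sum_standardize_pow {n : ℕ} (hn : n ≠ 0) (l : ℕ) (x : Fin n → ℝ) :
    ∑ i, standardize x i ^ l = n * (sampleCentralMoment l x / sampleSD x ^ l) := by
  have : (n : ℝ) ≠ 0 := Nat.cast_ne_zero.2 hn
  simp only [standardize, div_pow, ← Finset.sum_div, sampleCentralMoment]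
  field_simp

theorem sum_standardize_sq {n : ℕ} (hn : n ≠ 0) {x : Fin n → ℝ} (hx : sampleSD x ≠ 0) :
    ∑ i, standardize x i ^ 2 = n := by
  rw [sum_standardize_pow hn, sampleSD_sq, div_self, mul_one]
  rwa [← sampleSD_sq, pow_ne_zero_iff two_ne_zero]

theorem abs_standardize_le {n : ℕ} (x : Fin n → ℝ) (i : Fin n) : |standardize x i| ≤ √n := by
  -- For a degenerate sample, division by zero makes the standardized values `0`, so the bound holds
  -- for every sample.
  by_cases hx : sampleSD x = 0
  · simp [standardize, hx]
  refine Real.abs_le_sqrt ?_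
  rw [← sum_standardize_sq (Fin.pos i).ne' hx]
  exact Finset.single_le_sum (f := fun i => standardize x i ^ 2) (fun i _ => sq_nonneg _)
    (Finset.mem_univ i)

/-- Zero variance makes the first two coordinates equal, which confines the sample to a proper
subspace. -/
theorem ae_sampleSD_pos {n : ℕ} (hn : 2 ≤ n) : ∀ᵐ x : Fin n → ℝ, 0 < sampleSD x := by
  have h0 : (⟨0, by omega⟩ : Fin n) ≠ ⟨1, by omega⟩ := by simp
  let L : (Fin n → ℝ) →ₗ[ℝ] ℝ := LinearMap.proj ⟨0, by omega⟩ - LinearMap.proj ⟨1, by omega⟩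
  have hL : LinearMap.ker L ≠ ⊤ := by
    intro h
    have : L (Pi.single ⟨0, by omega⟩ 1) = 0 := by
      rw [← LinearMap.mem_ker, h]; trivial
    simp [L] at this
  have := Measure.addHaar_submodule volume _ hL
  refine measure_mono_null (fun x hx => ?_) this
  have hx0 : sampleCentralMoment 2 x = 0 := by
    rw [← sampleSD_sq, le_antisymm (not_lt.1 (show ¬ 0 < sampleSD x from hx)) (sampleSD_nonneg x), zero_pow two_ne_zero]
  have hn0 : (1 / (n : ℝ)) ≠ 0 := by positivity
  have h2 := (mul_eq_zero.1 hx0).resolve_left hn0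
  rw [Finset.sum_eq_zero_iff_of_nonneg fun i _ => sq_nonneg _] at h2
  have h3 : ∀ i, x i = sampleMean x := fun i => by
    simpa [sub_eq_zero] using h2 i (Finset.mem_univ i)
  simp [L, h3 ⟨0, by omega⟩, h3 ⟨1, by omega⟩]

/-! ### The orbit decomposition -/

/-- The Gaussian weight `∏ φ(a + b zᵢ)` of a standardized sample `z`. -/
noncomputable def orbitDensity (n : ℕ) (a b : ℝ) : ℝ :=
  ((√(2 * Real.pi))⁻¹) ^ n * Real.exp (-(n * (a ^ 2 + b ^ 2) / 2))

theorem orbitDensity_pos (n : ℕ) (a b : ℝ) : 0 < orbitDensity n a b := by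
  unfold orbitDensity; positivity

theorem prod_gaussianPDFReal {n : ℕ} (y : Fin n → ℝ) :
    ∏ i, gaussianPDFReal 0 1 (y i) =
      ((√(2 * Real.pi))⁻¹) ^ n * Real.exp (-(∑ i, y i ^ 2) / 2) := by
  simp only [gaussianPDFReal, Finset.prod_mul_distrib, Finset.prod_const, Finset.card_univ,
    Fintype.card_fin, ← Real.exp_sum, NNReal.coe_one, mul_one, sub_zero]
  rw [← Finset.sum_div, Finset.sum_neg_distrib]

theorem prod_gaussianPDFReal_standardize {n : ℕ} (hn : n ≠ 0) {y : Fin n → ℝ} (hy : sampleSD y ≠ 0)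
    (a b : ℝ) :
    ∏ i, gaussianPDFReal 0 1 (a + b * standardize y i) = orbitDensity n a b := by
  rw [prod_gaussianPDFReal, orbitDensity]
  have : ∑ i, (a + b * standardize y i) ^ 2 = n * (a ^ 2 + b ^ 2) := by
    have h : ∀ i, (a + b * standardize y i) ^ 2 =
        a ^ 2 + 2 * a * b * standardize y i + b ^ 2 * standardize y i ^ 2 := fun i => by ring
    simp only [h, Finset.sum_add_distrib, ← Finset.mul_sum, sum_standardize hn,
      sum_standardize_sq hn hy, Finset.sum_const, Finset.card_univ, Fintype.card_fin, nsmul_eq_mul]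
    ring
  rw [this]
  congr 2
  ring

theorem standardize_spec {n : ℕ} {y : Fin n → ℝ} (hy : sampleSD y ≠ 0) (i : Fin n) :
    y i = sampleMean y + sampleSD y * standardize y i := by
  rw [standardize]; field_simp; ring

/-- Integration over the parameters `a ∈ ℝ`, `b > 0` of the affine group. -/
noncomputable def orbitIntegral (F : ℝ → ℝ → ENNReal) : ENNReal :=
  ∫⁻ b in Set.Ioi (0 : ℝ), ∫⁻ a : ℝ, F a b

theorem orbitIntegral_scale {F : ℝ → ℝ → ENNReal} (hF : Measurable (Function.uncurry F)) {s : ℝ}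
    (hs : 0 < s) {v : ℝ → ℝ} (hv : Measurable v) {r : ℝ} (hr : 0 < r) :
    orbitIntegral F =
      ENNReal.ofReal (s * r) * orbitIntegral fun a b => F (v b + r * a) (s * b) := by
  unfold orbitIntegral
  have hm : Measurable fun b => ∫⁻ a, F a b := hF.lintegral_prod_left'
  have hF2 : Measurable fun p : ℝ × ℝ => F (v p.1 + r * p.2) (s * p.1) := 
    hF.comp (f := fun p : ℝ × ℝ => (v p.1 + r * p.2, s * p.1)) (by fun_prop)
  rw [setLIntegral_Ioi_eq_mul_scale hs hm, ENNReal.ofReal_mul hs.le, mul_assoc,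
    ← lintegral_const_mul _ hF2.lintegral_prod_right']
  congr 1
  refine lintegral_congr fun b => ?_
  exact lintegral_eq_mul_lintegral_affine hr (v b)
    (hF.comp (f := fun a => (a, s * b)) (by fun_prop))

theorem orbitIntegral_congr {F G : ℝ → ℝ → ENNReal} (h : ∀ a b, 0 < b → F a b = G a b) :
    orbitIntegral F = orbitIntegral G :=
  setLIntegral_congr_fun measurableSet_Ioi fun b hb => lintegral_congr fun a => h a b hb

theorem orbitIntegral_mono {F G : ℝ → ℝ → ENNReal} (h : ∀ a b, 0 < b → F a b ≤ G a b) :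
    orbitIntegral F ≤ orbitIntegral G :=
  setLIntegral_mono' measurableSet_Ioi fun b hb => lintegral_mono fun a => h a b hb

theorem orbitIntegral_const_mul {F : ℝ → ℝ → ENNReal} (hF : Measurable (Function.uncurry F))
    (c : ENNReal) : orbitIntegral (fun a b => c * F a b) = c * orbitIntegral F := by
  unfold orbitIntegral
  have hm : Measurable fun b => ∫⁻ a, F a b := hF.lintegral_prod_left'
  rw [← lintegral_const_mul _ hm]
  refine lintegral_congr fun b => lintegral_const_mul _ (hF.comp (f := fun a => (a, b)) (by fun_prop))

theorem lintegral_orbitIntegral_swap {α : Type*} [MeasurableSpace α] {μ : Measure α} [SFinite μ]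
    {G : α → ℝ → ℝ → ENNReal} (hG : Measurable fun p : α × ℝ × ℝ => G p.1 p.2.1 p.2.2) :
    ∫⁻ y, orbitIntegral (G y) ∂μ = orbitIntegral fun a b => ∫⁻ y, G y a b ∂μ := by
  unfold orbitIntegral
  rw [lintegral_lintegral_swap]
  · refine lintegral_congr fun b => ?_
    rw [lintegral_lintegral_swap]
    exact (hG.comp (f := fun p : α × ℝ => (p.1, p.2, b)) (by fun_prop)).aemeasurable
  · refine Measurable.aemeasurable ?_
    exact Measurable.lintegral_prod_right'
      (hG.comp (f := fun p : (α × ℝ) × ℝ => (p.1.1, p.2, p.1.2)) (by fun_prop))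

/-- The normalizing constant of the orbit decomposition. -/
noncomputable def orbitConst (n : ℕ) : ENNReal :=
  orbitIntegral fun a b => ENNReal.ofReal ((b ^ (n + 1))⁻¹ * orbitDensity n (-a / b) (1 / b))

/-- Parametrize the orbit from `y` itself rather than from its standardization, exchange integrals,
substitute `x = a + b y` for fixed `(a, b)`, exchange back, and recentre the parameters at `x`. What
multiplies `H x` is then the Gaussian weight of a standardized sample, which no longer depends on
`x`. The exponent `n - 2` is the one for which all powers of the standard deviation cancel. -/
theorem lintegral_gaussian_orbitIntegral {n : ℕ} (hn : 2 ≤ n) {H : (Fin n → ℝ) → ENNReal}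
    (hH : Measurable H) :
    ∫⁻ y : Fin n → ℝ, ENNReal.ofReal (∏ i, gaussianPDFReal 0 1 (y i)) *
      orbitIntegral (fun a b => H (fun i => a + b * standardize y i) * ENNReal.ofReal (b ^ (n - 2)))
      = orbitConst n * ∫⁻ x, H x := by
  obtain ⟨m, rfl⟩ := Nat.exists_eq_add_of_le' hn
  rw [Nat.add_sub_cancel]
  have hn0 : m + 2 ≠ 0 := by omega
  set γ : (Fin (m + 2) → ℝ) → ℝ := fun y => ∏ i, gaussianPDFReal 0 1 (y i) with hγ
  have hγm : Measurable γ := by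
    have := measurable_gaussianPDFReal 0 1
    rw [hγ]; fun_prop
  have hγ0 : ∀ y, 0 ≤ γ y := fun y => Finset.prod_nonneg fun i _ => gaussianPDFReal_nonneg _ _ _
  have hSm := measurable_sampleSD (n := m + 2)
  let G₁ : (Fin (m + 2) → ℝ) → ℝ → ℝ → ENNReal := fun y a b =>
    ENNReal.ofReal (γ y * sampleSD y ^ (m + 1) * b ^ m) * H (fun i => a + b * y i)
  -- `G₂` is `G₁` after `x = a + b y`: the point `y` becomes `(x - a) / b`, its standard deviation
  -- is divided by `b`, and the Jacobian contributes `(b ^ (m + 2))⁻¹`.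
  let G₂ : (Fin (m + 2) → ℝ) → ℝ → ℝ → ENNReal := fun x a b =>
    ENNReal.ofReal ((b ^ (m + 2))⁻¹ * (γ (fun i => -a / b + 1 / b * x i) *
      (1 / b * sampleSD x) ^ (m + 1) * b ^ m)) * H x
  have h₁ : ∀ᵐ y : Fin (m + 2) → ℝ, ENNReal.ofReal (γ y) * orbitIntegral
      (fun a b => H (fun i => a + b * standardize y i) * ENNReal.ofReal (b ^ m)) =
      orbitIntegral (G₁ y) := by
    filter_upwards [ae_sampleSD_pos hn] with y hy
    rw [orbitIntegral_scale (by unfold Function.uncurry; fun_prop) hy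
      (v := fun b => b * sampleMean y) (by fun_prop) one_pos, ← mul_assoc,
      ← orbitIntegral_const_mul (by unfold Function.uncurry; fun_prop)]
    refine orbitIntegral_congr fun a b hb => ?_
    have : (fun i => b * sampleMean y + 1 * a + sampleSD y * b * standardize y i) =
        fun i => a + b * y i := by
      ext i
      rw [standardize_spec hy.ne' i]; ring
    rw [this, mul_comm (H _), ← mul_assoc]
    congr 1
    have := hγ0 y
    rw [← ENNReal.ofReal_mul (by positivity), ← ENNReal.ofReal_mul (by positivity)]
    congr 1
    ring
  have h₂ : ∀ a b, 0 < b → ∫⁻ y, G₁ y a b = ∫⁻ x, G₂ x a b := by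
    intro a b hb
    have hm : Measurable fun x => G₂ x a b := by fun_prop
    rw [lintegral_pi_eq_mul_lintegral_affine hb a hm, ← lintegral_const_mul _ (by fun_prop)]
    refine lintegral_congr fun y => ?_
    have h1 : (fun i => -a / b + 1 / b * (a + b * y i)) = y := by
      ext i; field_simp; ring
    simp only [G₁, G₂, sampleSD_affine hn0 a hb y, h1, ← mul_assoc]
    rw [← ENNReal.ofReal_mul (by positivity)]
    congr 2
    field_simp
  have h₃ : ∀ᵐ x : Fin (m + 2) → ℝ, orbitIntegral (G₂ x) = orbitConst (m + 2) * H x := by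
    filter_upwards [ae_sampleSD_pos hn] with x hx
    rw [orbitIntegral_scale (by unfold Function.uncurry; fun_prop) hx
      (v := fun _ => sampleMean x) (by fun_prop) hx, orbitConst,
      ← orbitIntegral_const_mul (by unfold Function.uncurry; fun_prop), mul_comm _ (H x),
      ← orbitIntegral_const_mul (by unfold Function.uncurry orbitDensity; fun_prop)]
    refine orbitIntegral_congr fun a b hb => ?_
    have h1 : (fun i => -(sampleMean x + sampleSD x * a) / (sampleSD x * b)
        + 1 / (sampleSD x * b) * x i) = fun i => -a / b + 1 / b * standardize x i := by
      ext i
      rw [standardize_spec hx.ne' i]; field_simp; ring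
    have h2 : γ (fun i => -a / b + 1 / b * standardize x i) =
        orbitDensity (m + 2) (-a / b) (1 / b) :=
      prod_gaussianPDFReal_standardize hn0 hx.ne' _ _
    simp only [G₂, h1, h2]
    rw [← mul_assoc, mul_comm (H x)]
    congr 1
    rw [← ENNReal.ofReal_mul (by positivity)]
    congr 1
    generalize orbitDensity (m + 2) (-a / b) (1 / b) = d
    have hs : 1 / (sampleSD x * b) * sampleSD x = 1 / b := by field_simp
    rw [hs, one_div, inv_pow, mul_pow, mul_pow]
    field_simp
    ring
  rw [lintegral_congr_ae h₁, lintegral_orbitIntegral_swap (by fun_prop),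
    orbitIntegral_congr h₂, ← lintegral_orbitIntegral_swap (by fun_prop), lintegral_congr_ae h₃,
    lintegral_const_mul _ hH]

/-- Take `H` to be the normal likelihood in the orbit formula: its total mass is 1, and its integral
along an orbit is the same for almost every `y`. -/
theorem orbitConst_eq {n : ℕ} (hn : 2 ≤ n) : orbitConst n =
    orbitIntegral fun a b => ENNReal.ofReal (orbitDensity n a b * b ^ (n - 2)) := by
  have hm : Measurable fun y : Fin n → ℝ => ENNReal.ofReal (∏ i, gaussianPDFReal 0 1 (y i)) := by
    have := measurable_gaussianPDFReal 0 1
    fun_prop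
  have h1 : ∫⁻ y : Fin n → ℝ, ENNReal.ofReal (∏ i, gaussianPDFReal 0 1 (y i)) = 1 := by
    rw [volume_pi, ← ofReal_integral_eq_lintegral_ofReal
      (Integrable.fintype_prod fun i => integrable_gaussianPDFReal 0 1)
      (Filter.Eventually.of_forall fun y => Finset.prod_nonneg fun i _ =>
        gaussianPDFReal_nonneg _ _ _), integral_fintype_prod_eq_prod (fun _ => gaussianPDFReal 0 1)]
    simp [integral_gaussianPDFReal_eq_one]
  have key := lintegral_gaussian_orbitIntegral hn hm
  rw [h1, mul_one] at key
  rw [← key, ← mul_one (orbitIntegral _), ← h1, mul_comm, ← lintegral_mul_const _ hm]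
  refine lintegral_congr_ae ?_
  filter_upwards [ae_sampleSD_pos hn] with y hy
  congr 1
  refine orbitIntegral_congr fun a b hb => ?_
  rw [prod_gaussianPDFReal_standardize (by omega) hy.ne',
    ← ENNReal.ofReal_mul (orbitDensity_pos _ _ _).le]

/-! ### Difference quotients of the likelihood -/

/-- With `1 + θ rᵢ` the likelihood ratio of one observation, dividing by `θ` bounds the difference
quotient of the whole product by the individual quotients `rᵢ` alone. -/
theorem abs_prod_one_add_mul_sub_one_le {ι : Type*} (s : Finset ι) {θ : ℝ} (h0 : 0 ≤ θ) (h1 : θ ≤ 1)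
    (r : ι → ℝ) : |∏ i ∈ s, (1 + θ * r i) - 1| ≤ θ * (∏ i ∈ s, (1 + |r i|) - 1) := by
  classical
  induction s using Finset.induction_on with
  | empty => simp
  | insert j s hj ih =>
    rw [Finset.prod_insert hj, Finset.prod_insert hj]
    have e : (1 + θ * r j) * ∏ i ∈ s, (1 + θ * r i) - 1 =
      (∏ i ∈ s, (1 + θ * r i) - 1) * (1 + θ * r j) + θ * r j := by ring
    have h2 : |1 + θ * r j| ≤ 1 + |r j| := by
      refine (abs_add_le _ _).trans ?_
      rw [abs_one, abs_mul, abs_of_nonneg h0]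
      nlinarith [abs_nonneg (r j)]
    calc _ ≤ |∏ i ∈ s, (1 + θ * r i) - 1| * |1 + θ * r j| + θ * |r j| := by
          rw [e, ← abs_mul]
          refine (abs_add_le _ _).trans_eq ?_
          rw [abs_mul θ, abs_of_nonneg h0]
      _ ≤ θ * (∏ i ∈ s, (1 + |r i|) - 1) * (1 + |r j|) + θ * |r j| := by
          gcongr
          exact (abs_nonneg _).trans ih
      _ = _ := by ring

theorem ENNReal.one_add_pow_le (g : ENNReal) (n : ℕ) : (1 + g) ^ n ≤ 2 ^ n * (1 + g ^ n) := by
  have h : 1 + g ≤ 2 * max 1 g := by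
    rw [two_mul]; exact add_le_add (le_max_left _ _) (le_max_right _ _)
  refine (pow_le_pow_left' h n).trans ?_
  rw [mul_pow]
  gcongr
  rcases le_total 1 g with h | h
  · rw [max_eq_right h]; exact le_add_self
  · rw [max_eq_left h, one_pow]; exact le_self_add

namespace IsShapeFamily

variable {f : ℝ → ℝ → ℝ} {θ : ℝ} {n : ℕ}

theorem hasDerivWithinAt_log (hf : IsShapeFamily f) (x : ℝ) :
    HasDerivWithinAt (fun θ => Real.log (f θ x)) (scoreAtNormal f x) (Set.Ici 0) 0 :=
  ((hf.contDiff_log x).differentiableOn one_ne_zero 0 Set.self_mem_Ici).hasDerivWithinAt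

theorem differentiableOn (hf : IsShapeFamily f) (x : ℝ) :
    DifferentiableOn ℝ (fun θ => f θ x) (Set.Ici 0) := by
  refine ((hf.contDiff_log x).differentiableOn one_ne_zero).exp.congr fun θ hθ => ?_
  rw [Real.exp_log (hf.pos θ hθ x)]

theorem hasDerivWithinAt_prod (hf : IsShapeFamily f) (x : Fin n → ℝ) :
    HasDerivWithinAt (fun θ => ∏ i, f θ (x i)) ((∏ i, f 0 (x i)) * ∑ i, scoreAtNormal f (x i))
      (Set.Ici 0) 0 := by
  have h : ∀ θ ∈ Set.Ici (0 : ℝ), ∏ i, f θ (x i) = Real.exp (∑ i, Real.log (f θ (x i))) := by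
    intro θ hθ
    rw [Real.exp_sum]
    exact Finset.prod_congr rfl fun i _ => (Real.exp_log (hf.pos θ hθ _)).symm
  have h2 := (HasDerivWithinAt.fun_sum (u := Finset.univ) fun i _ =>
    hf.hasDerivWithinAt_log (x i)).exp
  rw [← h 0 Set.self_mem_Ici] at h2
  exact h2.congr h (h 0 Set.self_mem_Ici)

theorem tendsto_slope_prod (hf : IsShapeFamily f) (x : Fin n → ℝ) :
    Filter.Tendsto (fun θ => (∏ i, f θ (x i) - ∏ i, f 0 (x i)) / θ) (nhdsWithin 0 (Set.Ioi 0))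
      (nhds ((∏ i, f 0 (x i)) * ∑ i, scoreAtNormal f (x i))) := by
  have h := hasDerivWithinAt_iff_tendsto_slope.1 (hf.hasDerivWithinAt_prod x)
  rw [Set.Ici_sdiff_left] at h
  refine h.congr fun θ => ?_
  rw [slope_def_field, sub_zero]

/-- Mean value inequality in `θ` on `[0, ε]`; an infinite envelope is set aside first so that the
derivative bound is a real number. -/
theorem ofReal_diff_le_scoreEnvelope (hf : IsShapeFamily f) {ε : ℝ} {u : ℝ} (hu : u ∈ Set.Ioo 0 ε)
    (a b : ℝ) {z : ℝ} (hz : |z| ≤ √n) :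
    ENNReal.ofReal |(f u (a + b * z) - f 0 (a + b * z)) / (u * f 0 (a + b * z))| ≤
      scoreEnvelope f n ε a b := by
  by_cases htop : scoreEnvelope f n ε a b = ⊤
  · rw [htop]; exact le_top
  set x := a + b * z with hx
  have h0 := hf.pos 0 le_rfl x
  refine (ENNReal.ofReal_le_iff_le_toReal htop).2 ?_
  have hd : ∀ θ ∈ Set.Icc 0 ε, ‖derivWithin (fun t => f t x) (Set.Ici 0) θ‖ ≤
      (scoreEnvelope f n ε a b).toReal * f 0 x := by
    intro θ hθ
    rw [← div_le_iff₀ h0, Real.norm_eq_abs, ← ENNReal.ofReal_le_iff_le_toReal htop]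
    exact le_iSup₂_of_le z (abs_le.1 hz) (le_iSup₂_of_le (f := fun θ _ => ENNReal.ofReal
      (|derivWithin (fun t => f t (a + b * z)) (Set.Ici 0) θ| / f 0 (a + b * z))) θ hθ le_rfl)
  have hε : 0 ≤ ε := (hu.1.trans hu.2).le
  have := Convex.norm_image_sub_le_of_norm_hasDerivWithin_le (s := Set.Icc 0 ε)
    (fun θ hθ => ((hf.differentiableOn x θ hθ.1).hasDerivWithinAt).mono Set.Icc_subset_Ici_self)
    hd (convex_Icc 0 ε) (Set.left_mem_Icc.2 hε) (Set.Ioo_subset_Icc_self hu)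
  rw [sub_zero, Real.norm_eq_abs, Real.norm_eq_abs, abs_of_pos hu.1] at this
  rw [abs_div, abs_of_pos (mul_pos hu.1 h0), div_le_iff₀ (mul_pos hu.1 h0)]
  calc _ ≤ _ := this
    _ = _ := by ring

theorem abs_prod_sub_prod_div_le (hf : IsShapeFamily f) {u : ℝ} (hu : 0 < u) (hu1 : u ≤ 1)
    (x : Fin n → ℝ) :
    |(∏ i, f u (x i) - ∏ i, f 0 (x i)) / u| ≤
      (∏ i, f 0 (x i)) * ∏ i, (1 + |(f u (x i) - f 0 (x i)) / (u * f 0 (x i))|) := by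
  have h0 : ∀ i, 0 < f 0 (x i) := fun i => hf.pos 0 le_rfl _
  have hP : 0 < ∏ i, f 0 (x i) := Finset.prod_pos fun i _ => h0 i
  set r := fun i => (f u (x i) - f 0 (x i)) / (u * f 0 (x i)) with hr
  have h1 : ∏ i, f u (x i) = (∏ i, f 0 (x i)) * ∏ i, (1 + u * r i) := by
    rw [← Finset.prod_mul_distrib]
    refine Finset.prod_congr rfl fun i _ => ?_
    have := (h0 i).ne'
    simp only [hr]
    field_simp
    ring
  rw [abs_div, abs_of_pos hu, div_le_iff₀ hu, h1]
  have h2 := abs_prod_one_add_mul_sub_one_le Finset.univ hu.le hu1 r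
  have e : (∏ i, f 0 (x i)) * ∏ i, (1 + u * r i) - ∏ i, f 0 (x i) =
    (∏ i, f 0 (x i)) * (∏ i, (1 + u * r i) - 1) := by ring
  rw [e, abs_mul, abs_of_pos hP]
  calc _ ≤ (∏ i, f 0 (x i)) * (u * (∏ i, (1 + |r i|) - 1)) := by gcongr
    _ ≤ (∏ i, f 0 (x i)) * (u * ∏ i, (1 + |r i|)) := by gcongr; linarith
    _ = _ := by ring

theorem nullLaw_eq (hf : IsShapeFamily f) : nullLaw f n =
    volume.withDensity fun x : Fin n → ℝ => ENNReal.ofReal (∏ i, gaussianPDFReal 0 1 (x i)) := by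
  simp only [nullLaw, hf.sampleLaw_zero_one le_rfl, hf.normal_at_zero]

theorem measurable_likelihood (hf : IsShapeFamily f) (hθ : 0 ≤ θ) :
    Measurable fun x : Fin n → ℝ => ∏ i, f θ (x i) :=
  Finset.univ.measurable_prod fun i _ => (hf.measurable θ hθ).comp (measurable_pi_apply i)

theorem likelihood_pos (hf : IsShapeFamily f) (hθ : 0 ≤ θ) (x : Fin n → ℝ) :
    0 < ∏ i, f θ (x i) :=
  Finset.prod_pos fun _ _ => hf.pos θ hθ _

theorem ae_nullLaw_iff (hf : IsShapeFamily f) {P : (Fin n → ℝ) → Prop} :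
    (∀ᵐ x ∂nullLaw f n, P x) ↔ ∀ᵐ x, P x := by
  rw [nullLaw, hf.sampleLaw_zero_one le_rfl, ae_withDensity_iff
    (hf.measurable_likelihood le_rfl).ennreal_ofReal]
  simp [hf.likelihood_pos]

end IsShapeFamily

/-! ### Integration over the affine parameters -/

/-- The measure `db da` on the parameters `(b, a)` of the affine group. -/
noncomputable def orbitMeasure : Measure (ℝ × ℝ) :=
  (volume.restrict (Set.Ioi (0 : ℝ))).prod volume

instance : SFinite orbitMeasure := by unfold orbitMeasure; infer_instance

theorem lintegral_orbitMeasure {F : ℝ → ℝ → ENNReal} (hF : Measurable (Function.uncurry F)) :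
    ∫⁻ t, F t.2 t.1 ∂orbitMeasure = orbitIntegral F := by
  rw [orbitMeasure, lintegral_prod, orbitIntegral]
  exact (hF.comp measurable_swap).aemeasurable

theorem ae_orbitMeasure_pos : ∀ᵐ t ∂orbitMeasure, 0 < t.1 := by
  have h : ∀ᵐ b ∂(volume.restrict (Set.Ioi (0 : ℝ))), 0 < b := ae_restrict_mem measurableSet_Ioi
  exact Measure.quasiMeasurePreserving_fst.ae h

/-- The point `a + b z(y)`, with `p = (y, b, a)` and `z(y)` the standardized sample. -/
noncomputable def orbitPoint {n : ℕ} (p : (Fin n → ℝ) × ℝ × ℝ) (i : Fin n) : ℝ :=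
  p.2.2 + p.2.1 * standardize p.1 i

theorem measurable_orbitPoint {n : ℕ} : Measurable (orbitPoint (n := n)) := by
  refine measurable_pi_lambda _ fun i => ?_
  have := measurable_standardize i
  unfold orbitPoint
  fun_prop

theorem IsInvariantTest.apply_orbitPoint {n : ℕ} {φ : (Fin n → ℝ) → ℝ} (hφ : IsInvariantTest φ)
    {y : Fin n → ℝ} (hy : 0 < sampleSD y) (a : ℝ) {b : ℝ} (hb : 0 < b) :
    φ (fun i => a + b * standardize y i) = φ y := by
  rw [hφ.invariant a b hb, ← hφ.invariant _ _ hy (standardize y)]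
  congr 1
  ext i
  exact (standardize_spec hy.ne' i).symm

theorem orbitMeasure_ne_zero : orbitMeasure ≠ 0 := by
  intro h
  have h1 : orbitMeasure Set.univ = 0 := by rw [h]; simp
  rw [orbitMeasure, ← Set.univ_prod_univ, Measure.prod_prod] at h1
  simp at h1

theorem orbitConst_ne_zero {n : ℕ} (hn : 2 ≤ n) : orbitConst n ≠ 0 := by
  rw [orbitConst_eq hn, ← lintegral_orbitMeasure
    (by unfold Function.uncurry orbitDensity; fun_prop)]
  intro h
  rw [lintegral_eq_zero_iff (by unfold orbitDensity; fun_prop)] at h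
  have h2 : ∀ᵐ t ∂orbitMeasure, False := by
    filter_upwards [h, ae_orbitMeasure_pos] with t ht htp
    have := mul_pos (orbitDensity_pos n t.2 t.1) (pow_pos htp (n - 2))
    simp only [Pi.zero_apply, ENNReal.ofReal_eq_zero] at ht
    linarith
  rw [Filter.eventually_false_iff_eq_bot, ae_eq_bot] at h2
  exact orbitMeasure_ne_zero h2

theorem integrable_orbitDensity_monomial {n : ℕ} (hn : n ≠ 0) (k i j : ℕ) :
    Integrable (fun t : ℝ × ℝ => orbitDensity n t.2 t.1 * t.1 ^ k * (t.2 ^ i * t.1 ^ j))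
      orbitMeasure := by
  have hn' : (0 : ℝ) < n / 2 := by positivity
  have h : ∀ l : ℕ, Integrable (fun x : ℝ => x ^ l * Real.exp (-(n / 2) * x ^ 2)) := fun l => by
    have := integrable_rpow_mul_exp_neg_mul_sq hn' (s := l)
      (by have : (0 : ℝ) ≤ l := Nat.cast_nonneg l
          linarith)
    simpa only [Real.rpow_natCast] using this
  refine (((h (k + j)).restrict (s := Set.Ioi 0)).mul_prod ((h i).const_mul
    (((√(2 * Real.pi))⁻¹) ^ n))).congr (Filter.Eventually.of_forall fun t => ?_)
  have e : -(n * (t.2 ^ 2 + t.1 ^ 2) / 2) = -((n : ℝ) / 2) * t.1 ^ 2 + -(n / 2) * t.2 ^ 2 := by ring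
  simp only [orbitDensity, e, Real.exp_add]
  ring

theorem orbitConst_ne_top {n : ℕ} (hn : 2 ≤ n) : orbitConst n ≠ ⊤ := by
  rw [orbitConst_eq hn, ← lintegral_orbitMeasure
    (by unfold Function.uncurry orbitDensity; fun_prop)]
  have := (integrable_orbitDensity_monomial (by omega : n ≠ 0) (n - 2) 0 0).hasFiniteIntegral
  simp only [pow_zero, mul_one] at this
  refine ((lintegral_mono fun t => ?_).trans_lt this).ne
  exact Real.ofReal_le_enorm _

/-! ### The derivative of the power of an invariant test -/

/-- The envelope of the relative difference quotients along a sequence of parameters. -/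
noncomputable def quotientEnvelope (f : ℝ → ℝ → ℝ) (ε : ℝ) (u : ℕ → ℝ) (x : ℝ) : ENNReal :=
  ⨆ k, ⨆ _ : u k ∈ Set.Ioo 0 ε, ENNReal.ofReal |(f (u k) x - f 0 x) / (u k * f 0 x)|

/-- The integrable majorant of the difference quotients of the likelihood along the orbits. -/
noncomputable def orbitMajorant (f : ℝ → ℝ → ℝ) (n : ℕ) (ε : ℝ) (u : ℕ → ℝ)
    (p : (Fin n → ℝ) × ℝ × ℝ) : ENNReal :=
  ENNReal.ofReal ((∏ i, f 0 (orbitPoint p i)) * p.2.1 ^ (n - 2)) *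
    ∏ i, (1 + quotientEnvelope f ε u (orbitPoint p i))

namespace IsShapeFamily

variable {f : ℝ → ℝ → ℝ} {θ : ℝ} {n : ℕ}

theorem testPower_eq_integral (hf : IsShapeFamily f) (hθ : 0 ≤ θ) {φ : (Fin n → ℝ) → ℝ} :
    testPower f φ 0 1 θ = ∫ x, (∏ i, f θ (x i)) * φ x := by
  rw [testPower, hf.sampleLaw_zero_one hθ, integral_withDensity_eq_integral_toReal_smul
    (hf.measurable_likelihood hθ).ennreal_ofReal (Filter.Eventually.of_forall fun x =>
      ENNReal.ofReal_lt_top)]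
  simp only [ENNReal.toReal_ofReal (hf.likelihood_pos hθ _).le, smul_eq_mul]

/-- The orbit formula for the likelihood times `φ`; invariance lets `φ` be evaluated at `y` instead
of along its orbit. -/
theorem orbitConst_mul_lintegral (hf : IsShapeFamily f) (hn : 2 ≤ n) (hθ : 0 ≤ θ)
    {φ : (Fin n → ℝ) → ℝ} (hφ : IsInvariantTest φ) :
    ∫⁻ p, ENNReal.ofReal (φ p.1 * ((∏ i, f θ (orbitPoint p i)) * p.2.1 ^ (n - 2)))
      ∂(nullLaw f n).prod orbitMeasure =
      orbitConst n * ∫⁻ x, ENNReal.ofReal ((∏ i, f θ (x i)) * φ x) := by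
  have hL := hf.measurable_likelihood (n := n) hθ
  have hφm := hφ.measurable
  have hm : Measurable fun p : (Fin n → ℝ) × ℝ × ℝ =>
      ENNReal.ofReal (φ p.1 * ((∏ i, f θ (orbitPoint p i)) * p.2.1 ^ (n - 2))) := by
    have := hL.comp measurable_orbitPoint
    exact ((hφm.comp measurable_fst).mul (this.mul (by fun_prop))).ennreal_ofReal
  rw [lintegral_prod _ hm.aemeasurable, hf.nullLaw_eq, lintegral_withDensity_eq_lintegral_mul _
    (by have := measurable_gaussianPDFReal 0 1; fun_prop) hm.lintegral_prod_right',
    ← lintegral_gaussian_orbitIntegral hn (by fun_prop)]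
  refine lintegral_congr_ae ?_
  filter_upwards [ae_sampleSD_pos hn] with y hy
  rw [Pi.mul_apply, ← lintegral_orbitMeasure]
  · congr 1
    refine lintegral_congr_ae ?_
    filter_upwards [ae_orbitMeasure_pos] with t ht
    have h1 := (hφ.mem_Icc y).1
    have h2 := (hf.likelihood_pos hθ (fun i => t.2 + t.1 * standardize y i)).le
    rw [hφ.apply_orbitPoint hy _ ht, ← ENNReal.ofReal_mul (by positivity)]
    simp only [orbitPoint]
    congr 1
    ring
  · have h1 : Measurable fun p : ℝ × ℝ => fun i => p.1 + p.2 * standardize y i := by fun_prop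
    exact ((hL.comp h1).mul (hφm.comp h1)).ennreal_ofReal.mul (by fun_prop)

theorem integrable_orbit (hf : IsShapeFamily f) (hn : 2 ≤ n) (hθ : 0 ≤ θ)
    {φ : (Fin n → ℝ) → ℝ} (hφ : IsInvariantTest φ) :
    Integrable (fun p => φ p.1 * ((∏ i, f θ (orbitPoint p i)) * p.2.1 ^ (n - 2)))
      ((nullLaw f n).prod orbitMeasure) ∧
    ∫ p, φ p.1 * ((∏ i, f θ (orbitPoint p i)) * p.2.1 ^ (n - 2)) ∂(nullLaw f n).prod orbitMeasure =
      (orbitConst n).toReal * testPower f φ 0 1 θ := by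
  have hL := hf.measurable_likelihood (n := n) hθ
  have hφm := hφ.measurable
  have hm : Measurable fun p : (Fin n → ℝ) × ℝ × ℝ =>
      φ p.1 * ((∏ i, f θ (orbitPoint p i)) * p.2.1 ^ (n - 2)) := by
    have := hL.comp measurable_orbitPoint
    exact (hφm.comp measurable_fst).mul (this.mul (by fun_prop))
  have hpos : ∀ᵐ p ∂(nullLaw f n).prod orbitMeasure,
      0 ≤ φ p.1 * ((∏ i, f θ (orbitPoint p i)) * p.2.1 ^ (n - 2)) := by
    filter_upwards [Measure.quasiMeasurePreserving_snd.ae ae_orbitMeasure_pos] with p hp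
    have h1 := (hφ.mem_Icc p.1).1
    have h2 := (hf.likelihood_pos hθ (orbitPoint p)).le
    positivity
  have hpos' : ∀ x : Fin n → ℝ, 0 ≤ (∏ i, f θ (x i)) * φ x := fun x =>
    mul_nonneg (hf.likelihood_pos hθ x).le (hφ.mem_Icc x).1
  have key := hf.orbitConst_mul_lintegral hn hθ hφ
  have hfin : ∫⁻ x : Fin n → ℝ, ENNReal.ofReal ((∏ i, f θ (x i)) * φ x) ≠ ⊤ := by
    refine ((lintegral_mono fun x => ENNReal.ofReal_le_ofReal (?_ : _ ≤ ∏ i, f θ (x i))).trans_lt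
      ?_).ne
    · exact mul_le_of_le_one_right (hf.likelihood_pos hθ x).le (hφ.mem_Icc x).2
    · have h1 := (hf.isProbabilityMeasure_sampleLaw (n := n) hθ).measure_univ
      rw [hf.sampleLaw_zero_one hθ, withDensity_apply _ MeasurableSet.univ,
        Measure.restrict_univ] at h1
      rw [h1]; exact ENNReal.one_lt_top
  constructor
  · refine ⟨hm.aestronglyMeasurable, ?_⟩
    rw [hasFiniteIntegral_iff_ofReal hpos, key]
    exact ENNReal.mul_lt_top (orbitConst_ne_top hn).lt_top hfin.lt_top
  · rw [integral_eq_lintegral_of_nonneg_ae hpos hm.aestronglyMeasurable, key,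
      hf.testPower_eq_integral hθ, integral_eq_lintegral_of_nonneg_ae
        (Filter.Eventually.of_forall hpos') (hL.mul hφm).aestronglyMeasurable, ENNReal.toReal_mul]

theorem measurable_quotientEnvelope (hf : IsShapeFamily f) (ε : ℝ) (u : ℕ → ℝ) :
    Measurable (quotientEnvelope f ε u) := by
  refine .iSup fun k => ?_
  by_cases h : u k ∈ Set.Ioo 0 ε
  · have h1 := hf.measurable (u k) h.1.le
    have h0 := hf.measurable 0 le_rfl
    simp only [h, iSup_pos]
    exact ((h1.sub h0).div (h0.const_mul _)).abs.ennreal_ofReal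
  · simp [h]

theorem quotientEnvelope_le (hf : IsShapeFamily f) (ε : ℝ) (u : ℕ → ℝ) (a b : ℝ) {z : ℝ}
    (hz : |z| ≤ √n) : quotientEnvelope f ε u (a + b * z) ≤ scoreEnvelope f n ε a b :=
  iSup_le fun _ => iSup_le fun h => hf.ofReal_diff_le_scoreEnvelope h a b hz

theorem measurable_orbitMajorant (hf : IsShapeFamily f) (ε : ℝ) (u : ℕ → ℝ) :
    Measurable (orbitMajorant f n ε u) := by
  have h1 := hf.measurable_quotientEnvelope ε u
  refine Measurable.mul ?_ (Finset.univ.measurable_prod fun i _ => (h1.comp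
    ((measurable_pi_apply i).comp measurable_orbitPoint)).const_add 1)
  exact (((hf.measurable_likelihood le_rfl).comp measurable_orbitPoint).mul
    (by fun_prop)).ennreal_ofReal

/-- On almost every orbit the standardized values lie in `[-√n, √n]` and the Gaussian weight is that
of `(a, b)`, so the regularity condition bounds the orbit integral uniformly in `y`. The null law
has mass 1. -/
theorem lintegral_orbitMajorant_lt_top (hf : IsShapeFamily f) (hn : 2 ≤ n) {ε : ℝ}
    (hreg : (∫⁻ b in Set.Ioi (0 : ℝ), ∫⁻ a : ℝ, scoreEnvelope f n ε a b ^ n *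
      ENNReal.ofReal (Real.exp (-(n * (a ^ 2 + b ^ 2) / 2)) * b ^ (n - 2))) < ⊤) (u : ℕ → ℝ) :
    ∫⁻ p, orbitMajorant f n ε u p ∂(nullLaw f n).prod orbitMeasure < ⊤ := by
  have hm := hf.measurable_orbitMajorant (n := n) ε u
  have := hf.isProbabilityMeasure_sampleLaw (n := n) le_rfl
  have : IsProbabilityMeasure (nullLaw f n) := this
  rw [lintegral_prod _ hm.aemeasurable]
  set c : ENNReal := ENNReal.ofReal (((√(2 * Real.pi))⁻¹) ^ n) with hc
  set I := ∫⁻ b in Set.Ioi (0 : ℝ), ∫⁻ a : ℝ, scoreEnvelope f n ε a b ^ n *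
      ENNReal.ofReal (Real.exp (-(n * (a ^ 2 + b ^ 2) / 2)) * b ^ (n - 2)) with hI
  have hle : ∀ᵐ y ∂nullLaw f n, ∫⁻ t, orbitMajorant f n ε u (y, t) ∂orbitMeasure ≤
      2 ^ n * (orbitConst n + c * I) := by
    rw [hf.ae_nullLaw_iff]
    filter_upwards [ae_sampleSD_pos hn] with y hy
    have h0 := lintegral_orbitMeasure (F := fun a b => orbitMajorant f n ε u (y, b, a))
      (hm.comp (f := fun q : ℝ × ℝ => (y, q.2, q.1)) (by fun_prop))
    have h1 : ∀ a b, 0 < b → orbitMajorant f n ε u (y, b, a) ≤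
        2 ^ n * (ENNReal.ofReal (orbitDensity n a b * b ^ (n - 2)) + c * (scoreEnvelope f n ε a b ^ n *
      ENNReal.ofReal (Real.exp (-(n * (a ^ 2 + b ^ 2) / 2)) * b ^ (n - 2)))) := by
      intro a b hb
      have e1 : ∏ i, f 0 (orbitPoint (y, b, a) i) = orbitDensity n a b := by
        simp only [orbitPoint, hf.normal_at_zero]
        exact prod_gaussianPDFReal_standardize (by omega) hy.ne' a b
      have e2 : ENNReal.ofReal (orbitDensity n a b * b ^ (n - 2)) =
          c * ENNReal.ofReal (Real.exp (-(n * (a ^ 2 + b ^ 2) / 2)) * b ^ (n - 2)) := by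
        rw [hc, ← ENNReal.ofReal_mul (by positivity), orbitDensity, mul_assoc]
      have e3 : ∏ i, (1 + quotientEnvelope f ε u (orbitPoint (y, b, a) i)) ≤
          (1 + scoreEnvelope f n ε a b) ^ n := by
        refine (Finset.prod_le_pow_card _ _ (1 + scoreEnvelope f n ε a b) fun i _ => ?_).trans_eq ?_
        · gcongr
          exact hf.quotientEnvelope_le ε u a b (abs_standardize_le y i)
        · simp
      rw [orbitMajorant, e1]
      calc _ ≤ ENNReal.ofReal (orbitDensity n a b * b ^ (n - 2)) *
            (2 ^ n * (1 + scoreEnvelope f n ε a b ^ n)) := by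
            gcongr
            exact e3.trans (ENNReal.one_add_pow_le _ _)
        _ = 2 ^ n * (ENNReal.ofReal (orbitDensity n a b * b ^ (n - 2)) +
            ENNReal.ofReal (orbitDensity n a b * b ^ (n - 2)) * scoreEnvelope f n ε a b ^ n) := by
            ring
        _ = _ := by rw [e2]; ring
    rw [h0]
    refine (orbitIntegral_mono h1).trans_eq ?_
    -- `scoreEnvelope` is an uncountable supremum whose measurability is not established, so sums
    -- are split using measurability of the other summand and only finite constants are moved.
    have hmea : Measurable fun q : ℝ × ℝ =>
        ENNReal.ofReal (orbitDensity n q.2 q.1 * q.1 ^ (n - 2)) := by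
      unfold orbitDensity; fun_prop
    have h2n : (2 ^ n : ENNReal) ≠ ⊤ := by finiteness
    unfold orbitIntegral
    rw [orbitConst_eq hn, hI, orbitIntegral, ← lintegral_const_mul' c _ ENNReal.ofReal_ne_top,
      ← lintegral_add_left hmea.lintegral_prod_right', ← lintegral_const_mul' _ _ h2n]
    refine lintegral_congr fun b => ?_
    have hmb : Measurable fun a => ENNReal.ofReal (orbitDensity n a b * b ^ (n - 2)) := by
      unfold orbitDensity; fun_prop
    rw [← lintegral_const_mul' c _ ENNReal.ofReal_ne_top, ← lintegral_add_left hmb,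
      ← lintegral_const_mul' _ _ h2n]
  refine (lintegral_mono_ae hle).trans_lt ?_
  rw [lintegral_const, measure_univ, mul_one]
  refine ENNReal.mul_lt_top (by finiteness) (ENNReal.add_lt_top.2 ⟨(orbitConst_ne_top hn).lt_top,
    ENNReal.mul_lt_top ENNReal.ofReal_lt_top hreg⟩)

/-- Dominated convergence on the product of the null law and the affine parameters. -/
theorem tendsto_testPower_slope (hf : IsShapeFamily f) (hn : 2 ≤ n) (hreg : RegularityCondition f n)
    {φ : (Fin n → ℝ) → ℝ} (hφ : IsInvariantTest φ) :
    Filter.Tendsto (fun θ => (testPower f φ 0 1 θ - testPower f φ 0 1 0) / θ)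
      (nhdsWithin 0 (Set.Ioi 0)) (nhds ((orbitConst n).toReal⁻¹ *
        ∫ p, φ p.1 * ((∏ i, f 0 (orbitPoint p i)) * (∑ i, scoreAtNormal f (orbitPoint p i)) *
          p.2.1 ^ (n - 2)) ∂(nullLaw f n).prod orbitMeasure)) := by
  obtain ⟨ε, hε, hreg⟩ := hreg
  -- Along a sequence the majorant is a countable supremum, hence measurable.
  refine Filter.tendsto_of_seq_tendsto fun u hu => ?_
  have hK : (orbitConst n).toReal ≠ 0 :=
    ENNReal.toReal_ne_zero.2 ⟨orbitConst_ne_zero hn, orbitConst_ne_top hn⟩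
  have hfin := hf.lintegral_orbitMajorant_lt_top hn hreg u
  have hMm := hf.measurable_orbitMajorant (n := n) ε u
  -- Below `ε` the envelope applies; below `1` the product bound does.
  have hev : ∀ᶠ k in Filter.atTop, u k ∈ Set.Ioo 0 (min ε 1) :=
    hu.eventually (Ioo_mem_nhdsGT (lt_min hε one_pos))
  have hφm := hφ.measurable
  have hdct := tendsto_integral_filter_of_dominated_convergence
    (μ := (nullLaw f n).prod orbitMeasure) (l := Filter.atTop)
    (F := fun k p => φ p.1 * ((∏ i, f (u k) (orbitPoint p i) - ∏ i, f 0 (orbitPoint p i)) / u k *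
      p.2.1 ^ (n - 2)))
    (f := fun p => φ p.1 * ((∏ i, f 0 (orbitPoint p i)) * (∑ i, scoreAtNormal f (orbitPoint p i)) *
          p.2.1 ^ (n - 2)))
    (fun p => (orbitMajorant f n ε u p).toReal) ?_ ?_
    (integrable_toReal_of_lintegral_ne_top hMm.aemeasurable hfin.ne) ?_
  · refine (hdct.const_mul (orbitConst n).toReal⁻¹).congr' ?_
    filter_upwards [hev] with k hk
    obtain ⟨i1, e1⟩ := hf.integrable_orbit hn hk.1.le hφ
    obtain ⟨i0, e0⟩ := hf.integrable_orbit hn le_rfl hφ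
    rw [inv_mul_eq_iff_eq_mul₀ hK, Function.comp_apply, mul_div_assoc', mul_sub, ← e1, ← e0, ← integral_sub i1 i0,
      ← integral_div]
    congr 1
    ext p
    ring
  · filter_upwards [hev] with k hk
    have h1 := (hf.measurable_likelihood (n := n) hk.1.le).comp measurable_orbitPoint
    have h0 := (hf.measurable_likelihood (n := n) le_rfl).comp measurable_orbitPoint
    exact ((hφm.comp measurable_fst).mul (((h1.sub h0).div_const _).mul
      (by fun_prop))).aestronglyMeasurable
  · filter_upwards [hev] with k hk
    filter_upwards [Measure.quasiMeasurePreserving_snd.ae ae_orbitMeasure_pos,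
      ae_lt_top hMm hfin.ne] with p hp hlt
    have hk1 : u k ≤ 1 := hk.2.le.trans (min_le_right _ _)
    have hkε : u k ∈ Set.Ioo 0 ε := ⟨hk.1, hk.2.trans_le (min_le_left _ _)⟩
    have hL := hf.likelihood_pos le_rfl (orbitPoint p)
    refine (ENNReal.ofReal_le_iff_le_toReal hlt.ne).1 ?_
    refine (ENNReal.ofReal_le_ofReal (?_ : _ ≤ ((∏ i, f 0 (orbitPoint p i)) * p.2.1 ^ (n - 2)) *
      ∏ i, (1 + |(f (u k) (orbitPoint p i) - f 0 (orbitPoint p i)) /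
        (u k * f 0 (orbitPoint p i))|))).trans ?_
    · rw [norm_mul, norm_mul, Real.norm_eq_abs, Real.norm_eq_abs, Real.norm_eq_abs,
        abs_of_nonneg (hφ.mem_Icc _).1, abs_of_pos (pow_pos hp _)]
      refine (mul_le_of_le_one_left (by positivity) (hφ.mem_Icc _).2).trans ?_
      rw [mul_right_comm]
      gcongr
      exact hf.abs_prod_sub_prod_div_le hk.1 hk1 _
    · rw [ENNReal.ofReal_mul (by positivity), ENNReal.ofReal_prod_of_nonneg
        fun i _ => by positivity, orbitMajorant]
      gcongr with i
      rw [ENNReal.ofReal_add zero_le_one (abs_nonneg _), ENNReal.ofReal_one]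
      gcongr
      exact le_iSup₂_of_le (f := fun k (_ : u k ∈ Set.Ioo 0 ε) => ENNReal.ofReal
        |(f (u k) (orbitPoint p i) - f 0 (orbitPoint p i)) / (u k * f 0 (orbitPoint p i))|)
        k hkε le_rfl
  · refine Filter.Eventually.of_forall fun p => ?_
    exact (((hf.tendsto_slope_prod (orbitPoint p)).comp hu).mul_const _).const_mul _

end IsShapeFamily

/-! ### Locally best invariant tests -/

namespace IsShapeFamily

variable {f : ℝ → ℝ → ℝ} {θ : ℝ} {n : ℕ}

theorem testPower_congr_ae (hf : IsShapeFamily f) (hθ : 0 ≤ θ) {φ ψ : (Fin n → ℝ) → ℝ}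
    (h : φ =ᵐ[nullLaw f n] ψ) : testPower f φ 0 1 θ = testPower f ψ 0 1 θ := by
  rw [hf.testPower_eq_integral hθ, hf.testPower_eq_integral hθ]
  have h' : ∀ᵐ x, φ x = ψ x := hf.ae_nullLaw_iff.1 h
  refine integral_congr_ae ?_
  filter_upwards [h'] with x hx
  rw [hx]

/-- Neyman–Pearson: `(φ - ψ) * (S - k)` is nonnegative for the region's indicator `φ` and any test
`ψ`. Strict dominance over every `ψ` of the same level not almost surely equal to `φ` gives both
optimality and uniqueness. -/
theorem lbiTestGivenBy_of_slope (hf : IsShapeFamily f) {S : (Fin n → ℝ) → ℝ}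
    (hS : Measurable S) {C : ℝ} (hC : ∀ x, |S x| ≤ C)
    (hinv : ∀ a b : ℝ, 0 < b → ∀ x : Fin n → ℝ, S (fun i => a + b * x i) = S x)
    {A B : ℝ} (hB : 0 < B)
    (hslope : ∀ φ : (Fin n → ℝ) → ℝ, IsInvariantTest φ →
      Filter.Tendsto (fun θ => (testPower f φ 0 1 θ - testPower f φ 0 1 0) / θ)
        (nhdsWithin 0 (Set.Ioi 0))
        (nhds (A * ∫ x, φ x ∂nullLaw f n + B * ∫ x, φ x * S x ∂nullLaw f n))) :
    LBITestGivenBy f S := by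
  intro k hk
  have : IsProbabilityMeasure (nullLaw f n) := hf.isProbabilityMeasure_sampleLaw le_rfl
  set R : Set (Fin n → ℝ) := {x | k < S x} with hR
  have hRm : MeasurableSet R := measurableSet_lt measurable_const hS
  set φ : (Fin n → ℝ) → ℝ := R.indicator 1 with hφdef
  have hφ : IsInvariantTest φ := by
    refine ⟨measurable_one.indicator hRm, fun x => ?_, fun a b hb x => ?_⟩
    · by_cases h : x ∈ R <;> simp [φ, h]
    · simp only [φ, R, Set.indicator, Set.mem_ofPred_eq, hinv a b hb x, Pi.one_apply]
  have hφα : ∫ x, φ x ∂nullLaw f n = (nullLaw f n).real R := integral_indicator_one hRm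
  have hint : ∀ {ψ : (Fin n → ℝ) → ℝ}, IsInvariantTest ψ → Integrable ψ (nullLaw f n) :=
    fun hψ => .of_bound hψ.measurable.aestronglyMeasurable 1 (.of_forall fun x => by
      rw [Real.norm_eq_abs, abs_of_nonneg (hψ.mem_Icc x).1]; exact (hψ.mem_Icc x).2)
  have hintS : ∀ {ψ : (Fin n → ℝ) → ℝ}, IsInvariantTest ψ →
      Integrable (fun x => ψ x * S x) (nullLaw f n) := fun hψ =>
    (hint hψ).mul_bdd (c := C) hS.aestronglyMeasurable (.of_forall hC)
  have hstrict : ∀ ψ : (Fin n → ℝ) → ℝ, IsInvariantTest ψ →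
      HasLevel f ((nullLaw f n).real R) ψ → ¬ ψ =ᵐ[nullLaw f n] φ →
      ∀ᶠ θ in nhdsWithin 0 (Set.Ioi 0), testPower f ψ 0 1 θ < testPower f φ 0 1 θ := by
    intro ψ hψ hlev hne
    have hle : ∫ x, ψ x ∂nullLaw f n ≤ ∫ x, φ x ∂nullLaw f n := by
      rw [hφα]; exact hlev 0 1 one_pos
    have hnn : ∀ x, 0 ≤ (φ x - ψ x) * (S x - k) := by
      intro x
      by_cases hx : x ∈ R
      · have h1 : φ x = 1 := Set.indicator_of_mem hx _
        have h2 : k < S x := hx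
        rw [h1]
        exact mul_nonneg (sub_nonneg.2 (hψ.mem_Icc x).2) (sub_nonneg.2 h2.le)
      · have h1 : φ x = 0 := Set.indicator_of_notMem hx _
        have h2 : S x ≤ k := not_lt.1 hx
        rw [h1]
        exact mul_nonneg_of_nonpos_of_nonpos (by linarith [(hψ.mem_Icc x).1]) (sub_nonpos.2 h2)
    have hexp : ∀ x, (φ x - ψ x) * (S x - k) = (φ x * S x - ψ x * S x) - k * (φ x - ψ x) :=
      fun x => by ring
    have hIint : Integrable (fun x => (φ x - ψ x) * (S x - k)) (nullLaw f n) := by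
      simp only [hexp]
      exact ((hintS hφ).sub (hintS hψ)).sub (((hint hφ).sub (hint hψ)).const_mul k)
    -- A zero integral would make `φ = ψ` almost surely off `S = k`, which is a null set.
    have hpos : 0 < ∫ x, (φ x - ψ x) * (S x - k) ∂nullLaw f n := by
      refine lt_of_le_of_ne (integral_nonneg hnn) fun h0 => hne ?_
      have h1 := (integral_eq_zero_iff_of_nonneg hnn hIint).1 h0.symm
      have h2 : ∀ᵐ x ∂nullLaw f n, S x ≠ k := by
        rw [ae_iff]; simpa using hk
      filter_upwards [h1, h2] with x hx1 hx2
      rcases mul_eq_zero.1 hx1 with h | h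
      · linarith
      · exact absurd (sub_eq_zero.1 h) hx2
    simp only [hexp] at hpos
    have i1 : Integrable (fun x => φ x * S x - ψ x * S x) (nullLaw f n) :=
      (hintS hφ).sub (hintS hψ)
    have i2 : Integrable (fun x => k * (φ x - ψ x)) (nullLaw f n) :=
      ((hint hφ).sub (hint hψ)).const_mul k
    rw [integral_sub i1 i2,
      integral_sub (hintS hφ) (hintS hψ), integral_const_mul,
      integral_sub (hint hφ) (hint hψ)] at hpos
    have hself : ∀ᶠ θ : ℝ in nhdsWithin 0 (Set.Ioi 0), 0 < θ := self_mem_nhdsWithin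
    -- If `ψ` has smaller size, continuity of the power at `0` decides; if the sizes agree, the term
    -- with `A` cancels and the slopes are strictly ordered.
    rcases hle.lt_or_eq with hlt | heq
    · have hcont : ∀ χ : (Fin n → ℝ) → ℝ, IsInvariantTest χ →
          Filter.Tendsto (fun θ => testPower f χ 0 1 θ) (nhdsWithin 0 (Set.Ioi 0))
            (nhds (∫ x, χ x ∂nullLaw f n)) := by
        intro χ hχ
        have hid : Filter.Tendsto (fun θ : ℝ => θ) (nhdsWithin 0 (Set.Ioi 0)) (nhds 0) :=
          Filter.tendsto_id.mono_left nhdsWithin_le_nhds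
        have h1 := ((hslope χ hχ).mul hid).const_add (testPower f χ 0 1 0)
        rw [mul_zero, add_zero] at h1
        refine h1.congr' ?_
        filter_upwards [hself] with θ hθ
        field_simp
        ring
      exact (hcont ψ hψ).eventually_lt (hcont φ hφ) hlt
    · have hS' : ∫ x, ψ x * S x ∂nullLaw f n < ∫ x, φ x * S x ∂nullLaw f n := by
        rw [heq] at hpos
        linarith
      filter_upwards [hself, (hslope ψ hψ).eventually_lt (hslope φ hφ)
        (by rw [heq]; gcongr)] with θ hθ hlt
      rw [div_lt_div_iff_of_pos_right hθ] at hlt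
      have h0 : testPower f ψ 0 1 0 = testPower f φ 0 1 0 := heq
      linarith
  have hlevφ : HasLevel f ((nullLaw f n).real R) φ := fun a b hb => by
    rw [hf.testPower_eq le_rfl a hb hφ, ← hφα]; rfl
  have hLBI : IsLBITest f ((nullLaw f n).real R) φ := by
    refine ⟨hφ, hlevφ, fun ψ hψ hlev => ?_⟩
    by_cases h : ψ =ᵐ[nullLaw f n] φ
    · refine ⟨1, one_pos, fun θ hθ a b hb => ?_⟩
      rw [hf.testPower_eq hθ.1.le a hb hφ, hf.testPower_eq hθ.1.le a hb hψ,
        hf.testPower_congr_ae hθ.1.le h]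
    · obtain ⟨δ, hδ, hsub⟩ := mem_nhdsGT_iff_exists_Ioo_subset.1 (hstrict ψ hψ hlev h)
      refine ⟨δ, hδ, fun θ hθ a b hb => ?_⟩
      rw [hf.testPower_eq hθ.1.le a hb hφ, hf.testPower_eq hθ.1.le a hb hψ]
      exact (hsub hθ).le
  refine ⟨hLBI, fun ψ hψ => ?_⟩
  by_contra h
  obtain ⟨δ, hδ, hle⟩ := hψ.2.2 φ hφ hlevφ
  have h1 : ∀ᶠ θ in nhdsWithin 0 (Set.Ioi 0), testPower f φ 0 1 θ ≤ testPower f ψ 0 1 θ := by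
    filter_upwards [Ioo_mem_nhdsGT hδ] with θ hθ
    exact hle θ hθ 0 1 one_pos
  obtain ⟨θ, h2, h3⟩ := (h1.and (hstrict ψ hψ.1 hψ.2.1 h)).exists
  exact h2.not_gt h3

/-- Each term of the score sum separates into a factor in `(a, b)` and one in `y`, so the derivative
integral factorizes. `S'` is a nuisance statistic whose weight `o` integrates to zero. -/
theorem tendsto_testPower_slope_of_sum_eq (hf : IsShapeFamily f) (hn : 2 ≤ n)
    (hreg : RegularityCondition f n) {S S' : (Fin n → ℝ) → ℝ} (hS : Measurable S)
    (hS' : Measurable S') {C C' : ℝ} (hC : ∀ x, |S x| ≤ C) (hC' : ∀ x, |S' x| ≤ C')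
    {r h o : ℝ × ℝ → ℝ}
    (hr : Integrable (fun t => orbitDensity n t.2 t.1 * t.1 ^ (n - 2) * r t) orbitMeasure)
    (hh : Integrable (fun t => orbitDensity n t.2 t.1 * t.1 ^ (n - 2) * h t) orbitMeasure)
    (ho : Integrable (fun t => orbitDensity n t.2 t.1 * t.1 ^ (n - 2) * o t) orbitMeasure)
    (ho0 : ∫ t, orbitDensity n t.2 t.1 * t.1 ^ (n - 2) * o t ∂orbitMeasure = 0)
    (hsum : ∀ y : Fin n → ℝ, 0 < sampleSD y → ∀ t : ℝ × ℝ,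
      ∑ i, scoreAtNormal f (orbitPoint (y, t) i) = r t + h t * S y + o t * S' y)
    {φ : (Fin n → ℝ) → ℝ} (hφ : IsInvariantTest φ) :
    Filter.Tendsto (fun θ => (testPower f φ 0 1 θ - testPower f φ 0 1 0) / θ)
      (nhdsWithin 0 (Set.Ioi 0))
      (nhds ((orbitConst n).toReal⁻¹ *
        (∫ t, orbitDensity n t.2 t.1 * t.1 ^ (n - 2) * r t ∂orbitMeasure) *
          ∫ x, φ x ∂nullLaw f n +
        (orbitConst n).toReal⁻¹ *
        (∫ t, orbitDensity n t.2 t.1 * t.1 ^ (n - 2) * h t ∂orbitMeasure) *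
          ∫ x, φ x * S x ∂nullLaw f n)) := by
  have : IsProbabilityMeasure (nullLaw f n) := hf.isProbabilityMeasure_sampleLaw le_rfl
  have hint : Integrable φ (nullLaw f n) :=
    .of_bound hφ.measurable.aestronglyMeasurable 1 (.of_forall fun x => by
      rw [Real.norm_eq_abs, abs_of_nonneg (hφ.mem_Icc x).1]; exact (hφ.mem_Icc x).2)
  have hi1 : Integrable (fun x => φ x * S x) (nullLaw f n) :=
    hint.mul_bdd (c := C) hS.aestronglyMeasurable (.of_forall hC)
  have hi2 : Integrable (fun x => φ x * S' x) (nullLaw f n) :=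
    hint.mul_bdd (c := C') hS'.aestronglyMeasurable (.of_forall hC')
  have key := hf.tendsto_testPower_slope hn hreg hφ
  convert key using 2
  set W : ℝ × ℝ → ℝ := fun t => orbitDensity n t.2 t.1 * t.1 ^ (n - 2) with hW
  have hsd : ∀ᵐ y ∂nullLaw f n, 0 < sampleSD y := hf.ae_nullLaw_iff.2 (ae_sampleSD_pos hn)
  have e : ∀ᵐ p ∂(nullLaw f n).prod orbitMeasure,
      φ p.1 * ((∏ i, f 0 (orbitPoint p i)) * (∑ i, scoreAtNormal f (orbitPoint p i)) *
          p.2.1 ^ (n - 2)) =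
      φ p.1 * (W p.2 * r p.2) + φ p.1 * S p.1 * (W p.2 * h p.2) +
        φ p.1 * S' p.1 * (W p.2 * o p.2) := by
    filter_upwards [Measure.quasiMeasurePreserving_fst.ae hsd] with p hp
    have e1 : ∏ i, f 0 (orbitPoint p i) = orbitDensity n p.2.2 p.2.1 := by
      simp only [orbitPoint, hf.normal_at_zero]
      exact prod_gaussianPDFReal_standardize (by omega) hp.ne' _ _
    rw [e1, show p = (p.1, p.2) from rfl, hsum p.1 hp p.2]
    simp only [W]
    ring
  have i1 : Integrable (fun p : (Fin n → ℝ) × ℝ × ℝ => φ p.1 * (W p.2 * r p.2) +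
      φ p.1 * S p.1 * (W p.2 * h p.2)) ((nullLaw f n).prod orbitMeasure) :=
    (hint.mul_prod hr).add (hi1.mul_prod hh)
  rw [integral_congr_ae e, integral_add i1 (hi2.mul_prod ho),
    integral_add (hint.mul_prod hr) (hi1.mul_prod hh),
    integral_prod_mul φ fun t => W t * r t, integral_prod_mul (fun x => φ x * S x)
    fun t => W t * h t, integral_prod_mul (fun x => φ x * S' x) fun t => W t * o t]
  rw [ho0]
  ring

end IsShapeFamily

/-! ### Gaussian moments of the affine parameters -/

theorem integral_orbitDensity_pow_pos {n : ℕ} (hn : n ≠ 0) (k j : ℕ) :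
    0 < ∫ t : ℝ × ℝ, orbitDensity n t.2 t.1 * t.1 ^ k * t.1 ^ j ∂orbitMeasure := by
  have hpos : ∀ᵐ t ∂orbitMeasure, 0 < orbitDensity n t.2 t.1 * t.1 ^ k * t.1 ^ j := by
    filter_upwards [ae_orbitMeasure_pos] with t ht
    have := orbitDensity_pos n t.2 t.1
    positivity
  have hi := integrable_orbitDensity_monomial hn k 0 j
  simp only [pow_zero, one_mul] at hi
  refine lt_of_le_of_ne (integral_nonneg_of_ae (hpos.mono fun t ht => ht.le)) fun h0 => ?_
  have h := (integral_eq_zero_iff_of_nonneg_ae (hpos.mono fun t ht => ht.le) hi).1 h0.symm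
  have h2 : ∀ᵐ t ∂orbitMeasure, False := by
    filter_upwards [h, hpos] with t h1 h2
    exact h2.ne' h1
  rw [Filter.eventually_false_iff_eq_bot, ae_eq_bot] at h2
  exact orbitMeasure_ne_zero h2

theorem integral_orbitDensity_odd (n k j : ℕ) :
    ∫ t : ℝ × ℝ, orbitDensity n t.2 t.1 * t.1 ^ k * (t.2 * t.1 ^ j) ∂orbitMeasure = 0 := by
  have h1 : (fun t : ℝ × ℝ => orbitDensity n t.2 t.1 * t.1 ^ k * (t.2 * t.1 ^ j)) = fun t =>
      (((√(2 * Real.pi))⁻¹) ^ n * t.1 ^ (k + j) * Real.exp (-(n / 2) * t.1 ^ 2)) *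
        (t.2 * Real.exp (-(n / 2) * t.2 ^ 2)) := by
    ext t
    have e : -(n * (t.2 ^ 2 + t.1 ^ 2) / 2) = -((n : ℝ) / 2) * t.1 ^ 2 + -(n / 2) * t.2 ^ 2 := by
      ring
    simp only [orbitDensity, e, Real.exp_add]
    ring
  have h2 : ∫ a : ℝ, a * Real.exp (-((n : ℝ) / 2) * a ^ 2) = 0 := by
    have := integral_neg_eq_self (fun a : ℝ => a * Real.exp (-((n : ℝ) / 2) * a ^ 2)) volume
    simp only [neg_sq, neg_mul, integral_neg] at this ⊢
    linarith
  rw [h1, orbitMeasure, integral_prod_mul (fun b : ℝ => ((√(2 * Real.pi))⁻¹) ^ n * b ^ (k + j) *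
    Real.exp (-(n / 2) * b ^ 2)) (fun a : ℝ => a * Real.exp (-((n : ℝ) / 2) * a ^ 2)), h2, mul_zero]

/-! ### Null sets of polynomial statistics -/

/-- By Fubini over pairs `(v, t)`, for almost every `t` the zero set pulled back along `v ↦ x₀ + t
v` is null; any such `t ≠ 0` suffices, as this map scales volume by a nonzero factor. -/
theorem volume_zeros_eq_zero_of_lines {n : ℕ} {F : (Fin n → ℝ) → ℝ} (hF : Measurable F)
    (x₀ : Fin n → ℝ) (h : ∀ v : Fin n → ℝ, volume {t : ℝ | F (x₀ + t • v) = 0} = 0) :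
    volume {x | F x = 0} = 0 := by
  have hE : MeasurableSet {q : (Fin n → ℝ) × ℝ | F (x₀ + q.2 • q.1) = 0} :=
    measurableSet_eq_fun (hF.comp (by fun_prop)) measurable_const
  have h1 : ((volume : Measure (Fin n → ℝ)).prod (volume : Measure ℝ))
      {q : (Fin n → ℝ) × ℝ | F (x₀ + q.2 • q.1) = 0} = 0 :=
    (Measure.measure_prod_null hE).2 (.of_forall h)
  have h2 : ((volume : Measure ℝ).prod (volume : Measure (Fin n → ℝ)))
      {q : ℝ × (Fin n → ℝ) | F (x₀ + q.1 • q.2) = 0} = 0 := by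
    have hE' : MeasurableSet {q : ℝ × (Fin n → ℝ) | F (x₀ + q.1 • q.2) = 0} :=
      measurableSet_eq_fun (hF.comp (by fun_prop)) measurable_const
    rw [← Measure.prod_swap, Measure.map_apply measurable_swap hE']
    exact h1
  have h3 := Measure.ae_ae_of_ae_prod (measure_eq_zero_iff_ae_notMem.1 h2)
  have h4 : ∀ᵐ t : ℝ, t ≠ 0 := by
    rw [ae_iff]; simp
  obtain ⟨t, ht, ht0⟩ := (h3.and h4).exists
  have h5 : volume ((t • ·) ⁻¹' ((x₀ + ·) ⁻¹' {x : Fin n → ℝ | F x = 0})) = 0 :=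
    measure_eq_zero_iff_ae_notMem.2 ht
  rw [Measure.addHaar_preimage_smul _ ht0, measure_preimage_add] at h5
  refine (mul_eq_zero.1 h5).resolve_left ?_
  rw [ENNReal.ofReal_eq_zero, not_le]
  positivity

theorem sampleMean_add_smul {n : ℕ} (x v : Fin n → ℝ) (t : ℝ) :
    sampleMean (x + t • v) = sampleMean x + t * sampleMean v := by
  simp only [sampleMean, Pi.add_apply, Pi.smul_apply, smul_eq_mul, Finset.sum_add_distrib,
    ← Finset.mul_sum]
  ring

/-- The `l`-th central moment along the line `t ↦ x + t v`, a polynomial in `t`. -/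
noncomputable def centralMomentPoly {n : ℕ} (l : ℕ) (x v : Fin n → ℝ) : Polynomial ℝ :=
  Polynomial.C (1 / (n : ℝ)) * ∑ i, (Polynomial.C (x i - sampleMean x) +
    Polynomial.X * Polynomial.C (v i - sampleMean v)) ^ l

theorem eval_centralMomentPoly {n : ℕ} (l : ℕ) (x v : Fin n → ℝ) (t : ℝ) :
    (centralMomentPoly l x v).eval t = sampleCentralMoment l (x + t • v) := by
  simp only [centralMomentPoly, Polynomial.eval_mul, Polynomial.eval_C, Polynomial.eval_finsetSum,
    Polynomial.eval_pow, Polynomial.eval_add, Polynomial.eval_X, sampleCentralMoment,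
    sampleMean_add_smul, Pi.add_apply, Pi.smul_apply, smul_eq_mul]
  congr 1
  refine Finset.sum_congr rfl fun i _ => ?_
  ring

/-- On every line through `x₀` the relation is a polynomial in `t`, nonzero at `t = 0`, with
finitely many roots. One witness `x₀` is therefore enough. -/
theorem volume_centralMoment_relation {n : ℕ} (l m : ℕ) (c : ℝ) (j i : ℕ) (x₀ : Fin n → ℝ)
    (h : sampleCentralMoment l x₀ ^ j - c * sampleCentralMoment m x₀ ^ i ≠ 0) :
    volume {x : Fin n → ℝ | sampleCentralMoment l x ^ j - c * sampleCentralMoment m x ^ i = 0}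
      = 0 := by
  have hl := measurable_sampleCentralMoment (n := n) l
  have hm := measurable_sampleCentralMoment (n := n) m
  refine volume_zeros_eq_zero_of_lines (by fun_prop) x₀ fun v => ?_
  set P := centralMomentPoly l x₀ v ^ j - Polynomial.C c * centralMomentPoly m x₀ v ^ i with hP
  have hev : ∀ t, P.eval t = sampleCentralMoment l (x₀ + t • v) ^ j -
      c * sampleCentralMoment m (x₀ + t • v) ^ i := fun t => by
    simp [hP, eval_centralMomentPoly]
  have hP0 : P ≠ 0 := by
    intro h0
    have := hev 0
    rw [h0, zero_smul, add_zero, Polynomial.eval_zero] at this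
    exact h this.symm
  simp only [← hev]
  exact (Polynomial.finite_setOfPred_isRoot hP0).measure_zero _

theorem sampleCentralMoment_single {n : ℕ} (l : ℕ) :
    sampleCentralMoment l (Pi.single 0 1 : Fin (n + 1) → ℝ) =
      ((n / (n + 1) : ℝ) ^ l + n * (-1 / (n + 1)) ^ l) / (n + 1) := by
  have h1 : (n : ℝ) + 1 ≠ 0 := by positivity
  have hmean : sampleMean (Pi.single 0 1 : Fin (n + 1) → ℝ) = 1 / (n + 1) := by
    simp [sampleMean]
  rw [sampleCentralMoment, hmean, Fin.sum_univ_succ]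
  have e : (1 : ℝ) - 1 / (n + 1) = n / (n + 1) := by field_simp; ring
  simp only [Pi.single_eq_same, e, Pi.single_apply, Fin.succ_ne_zero, if_false, zero_sub,
    Finset.sum_const, Finset.card_univ, Fintype.card_fin, nsmul_eq_mul]
  push_cast
  rw [neg_div]
  ring

theorem sampleCentralMoment_cons_neg {n : ℕ} {l : ℕ} (hl : l ≠ 0) :
    sampleCentralMoment l (Fin.cons 1 (Fin.cons (-1) 0) : Fin (n + 2) → ℝ) =
      (1 + (-1) ^ l) / (n + 2) := by
  have hmean : sampleMean (Fin.cons 1 (Fin.cons (-1) 0) : Fin (n + 2) → ℝ) = 0 := by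
    simp [sampleMean, Fin.sum_univ_succ]
  rw [sampleCentralMoment, hmean]
  simp [Fin.sum_univ_succ, hl]
  ring

theorem volume_sampleSkewness_eq {n : ℕ} (hn : 3 ≤ n) (k : ℝ) :
    volume {x : Fin n → ℝ | sampleSkewness x = k} = 0 := by
  obtain ⟨m, rfl⟩ := Nat.exists_eq_add_of_le' hn
  -- Squaring removes the square root in `sampleSD ^ 3`. The sample `(1, -1, 0, …)` has zero third
  -- and positive second moment, a witness for `k ≠ 0`. A unit vector handles `k = 0`: its third
  -- moment has the factor `m + 1 = n - 2`, positive since `n ≥ 3`.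
  have key : volume {x : Fin (m + 3) → ℝ |
      sampleCentralMoment 3 x ^ 2 - k ^ 2 * sampleCentralMoment 2 x ^ 3 = 0} = 0 := by
    by_cases hk : k = 0
    · refine volume_centralMoment_relation _ _ _ _ _ (Pi.single 0 1 : Fin (m + 2 + 1) → ℝ) ?_
      rw [hk, sampleCentralMoment_single]
      push_cast
      have : ((m : ℝ) + 2) * (m + 1) * (m + 3) / (m + 3) ^ 4 ≠ 0 := by positivity
      have e : ((((m : ℝ) + 2) / (m + 2 + 1)) ^ 3 + (m + 2) * (-1 / (m + 2 + 1)) ^ 3) /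
          (m + 2 + 1) = ((m : ℝ) + 2) * (m + 1) * (m + 3) / (m + 3) ^ 4 := by
        rw [show (m : ℝ) + 2 + 1 = m + 3 by ring]
        field_simp
        ring
      rw [e]
      simpa using this
    · refine volume_centralMoment_relation _ _ _ _ _
        (Fin.cons 1 (Fin.cons (-1) 0) : Fin (m + 1 + 2) → ℝ) ?_
      rw [sampleCentralMoment_cons_neg three_ne_zero, sampleCentralMoment_cons_neg two_ne_zero]
      have : ((m + 1 : ℕ) : ℝ) + 2 ≠ 0 := by positivity
      norm_num
      exact ⟨hk, by exact_mod_cast this⟩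
  refine measure_mono_null_ae ?_ key
  filter_upwards [ae_sampleSD_pos (n := m + 3) (by omega)] with x hx hxk
  have h1 : sampleCentralMoment 3 x = k * sampleSD x ^ 3 := by
    rw [← show sampleSkewness x = k from hxk, sampleSkewness]; field_simp
  change sampleCentralMoment 3 x ^ 2 - k ^ 2 * sampleCentralMoment 2 x ^ 3 = 0
  rw [h1, ← sampleSD_sq]
  ring

theorem volume_sampleKurtosis_eq {n : ℕ} (hn : 4 ≤ n) (k : ℝ) :
    volume {x : Fin n → ℝ | sampleKurtosis x = k} = 0 := by
  obtain ⟨m, rfl⟩ := Nat.exists_eq_add_of_le' hn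
  have key : volume {x : Fin (m + 4) → ℝ |
      sampleCentralMoment 4 x ^ 1 - k * sampleCentralMoment 2 x ^ 2 = 0} = 0 := by
    -- The kurtosis of `(1, -1, 0, …)` is exactly `n / 2`, so that sample serves every other `k`. At
    -- `k = n / 2` a unit vector works, the discrepancy having the factor `m + 1 = n - 3`.
    by_cases hk : k = (m + 4) / 2
    · refine volume_centralMoment_relation _ _ _ _ _ (Pi.single 0 1 : Fin (m + 3 + 1) → ℝ) ?_
      rw [hk, sampleCentralMoment_single, sampleCentralMoment_single]
      push_cast
      have : (((m : ℝ) + 3) * (m + 1) * (m + 2)) / (2 * (m + 4) ^ 4) ≠ 0 := by positivity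
      convert this using 1
      rw [show (m : ℝ) + 3 + 1 = m + 4 by ring]
      field_simp
      ring
    · refine volume_centralMoment_relation _ _ _ _ _
        (Fin.cons 1 (Fin.cons (-1) 0) : Fin (m + 2 + 2) → ℝ) ?_
      rw [sampleCentralMoment_cons_neg four_ne_zero, sampleCentralMoment_cons_neg two_ne_zero]
      push_cast
      rw [show (m : ℝ) + 2 + 2 = m + 4 by ring]
      intro h0
      apply hk
      field_simp at h0
      linarith
  refine measure_mono_null_ae ?_ key
  filter_upwards [ae_sampleSD_pos (n := m + 4) (by omega)] with x hx hxk
  have h1 : sampleCentralMoment 4 x = k * sampleSD x ^ 4 := by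
    rw [← show sampleKurtosis x = k from hxk, sampleKurtosis]; field_simp
  change sampleCentralMoment 4 x ^ 1 - k * sampleCentralMoment 2 x ^ 2 = 0
  rw [h1, ← sampleSD_sq]
  ring

/-! ### Critical values -/

theorem continuous_cdf (μ : Measure ℝ) [IsProbabilityMeasure μ] (h : ∀ k, μ {k} = 0) :
    Continuous (cdf μ) := by
  refine continuous_iff_continuousAt.2 fun k => ?_
  rw [(monotone_cdf μ).continuousAt_iff_leftLim_eq_rightLim, StieltjesFunction.rightLim_eq]
  refine le_antisymm ((monotone_cdf μ).leftLim_le le_rfl) ?_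
  have := h k
  rw [← measure_cdf μ, StieltjesFunction.measure_singleton, ENNReal.ofReal_eq_zero] at this
  linarith

/-- Without atoms the distribution function of `S` is continuous, so it takes the value `1 - α`. -/
theorem exists_measureReal_lt_eq {Ω : Type*} [MeasurableSpace Ω] (μ : Measure Ω)
    [IsProbabilityMeasure μ] {S : Ω → ℝ} (hS : Measurable S) (h : ∀ k, μ {x | S x = k} = 0)
    {α : ℝ} (hα : α ∈ Set.Ioo (0 : ℝ) 1) : ∃ k, μ.real {x | k < S x} = α := by
  have := Measure.isProbabilityMeasure_map (μ := μ) hS.aemeasurable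
  have hc : Continuous (cdf (μ.map S)) := continuous_cdf _ fun k => by
    rw [Measure.map_apply hS (measurableSet_singleton k)]; exact h k
  obtain ⟨k, hk⟩ := mem_range_of_exists_le_of_exists_ge hc
    ((tendsto_cdf_atBot (μ.map S)).eventually_le_const (sub_pos.2 hα.2)).exists
    ((tendsto_cdf_atTop (μ.map S)).eventually_const_le (sub_lt_self 1 hα.1)).exists
  refine ⟨k, ?_⟩
  rw [cdf_eq_real, map_measureReal_apply hS measurableSet_Iic] at hk
  have h1 := probReal_compl_eq_one_sub (μ := μ) (hS measurableSet_Iic : MeasurableSet (S ⁻¹' Set.Iic k))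
  rw [hk, sub_sub_cancel] at h1
  rw [← h1]
  congr 1
  ext x
  simp

theorem IsShapeFamily.hasAllCriticalValues {f : ℝ → ℝ → ℝ} (hf : IsShapeFamily f) {n : ℕ}
    {S : (Fin n → ℝ) → ℝ} (hS : Measurable S) (h : ∀ k, volume {x | S x = k} = 0) :
    HasAllCriticalValues f S := by
  have : IsProbabilityMeasure (nullLaw f n) := hf.isProbabilityMeasure_sampleLaw le_rfl
  have h0 : ∀ k, nullLaw f n {x | S x = k} = 0 := fun k =>
    measure_eq_zero_iff_ae_notMem.2 (hf.ae_nullLaw_iff.2 (measure_eq_zero_iff_ae_notMem.1 (h k)))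
  exact ⟨h0, fun α hα => exists_measureReal_lt_eq _ hS h0 hα⟩

/-! ### Skewness and kurtosis -/

theorem measurable_sampleSkewness {n : ℕ} : Measurable (sampleSkewness (n := n)) :=
  (measurable_sampleCentralMoment 3).div (measurable_sampleSD.pow_const 3)

theorem measurable_sampleKurtosis {n : ℕ} : Measurable (sampleKurtosis (n := n)) :=
  (measurable_sampleCentralMoment 4).div (measurable_sampleSD.pow_const 4)

theorem abs_centralMoment_div_le {n : ℕ} (hn : n ≠ 0) (l : ℕ) (x : Fin n → ℝ) :
    |sampleCentralMoment l x / sampleSD x ^ l| ≤ √n ^ l := by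
  have h0 : (0 : ℝ) < n := by positivity
  have h1 : (n : ℝ) * |sampleCentralMoment l x / sampleSD x ^ l| ≤ n * √n ^ l := by
    rw [← abs_of_pos h0, ← abs_mul, abs_of_pos h0, ← sum_standardize_pow hn]
    refine (Finset.abs_sum_le_sum_abs _ _).trans ?_
    refine (Finset.sum_le_card_nsmul _ _ (√n ^ l) fun i _ => ?_).trans_eq (by simp)
    rw [abs_pow]
    exact pow_le_pow_left₀ (abs_nonneg _) (abs_standardize_le x i) l
  exact le_of_mul_le_mul_left h1 h0

theorem centralMoment_div_affine {n : ℕ} (hn : n ≠ 0) (l : ℕ) (a : ℝ) {b : ℝ} (hb : 0 < b)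
    (x : Fin n → ℝ) :
    sampleCentralMoment l (fun i => a + b * x i) / sampleSD (fun i => a + b * x i) ^ l =
      sampleCentralMoment l x / sampleSD x ^ l := by
  rw [sampleCentralMoment_affine hn, sampleSD_affine hn a hb, mul_pow,
    mul_div_mul_left _ _ (pow_ne_zero _ hb.ne')]

/-- Expand in powers of the standardized values, whose power sums are `n`, `0`, `n`, `n` times the
skewness and `n` times the kurtosis. -/
theorem sum_quartic_standardize {n : ℕ} (hn : n ≠ 0) {y : Fin n → ℝ} (hy : 0 < sampleSD y)
    (c₀ c₁ c₂ c₃ c₄ a b : ℝ) :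
    ∑ i, (c₀ + c₁ * (a + b * standardize y i) + c₂ * (a + b * standardize y i) ^ 2 +
      c₃ * (a + b * standardize y i) ^ 3 + c₄ * (a + b * standardize y i) ^ 4) =
    n * (c₀ + c₁ * a + c₂ * a ^ 2 + c₃ * a ^ 3 + c₄ * a ^ 4 +
      b ^ 2 * (c₂ + 3 * c₃ * a + 6 * c₄ * a ^ 2)) +
      n * b ^ 3 * (c₃ + 4 * c₄ * a) * sampleSkewness y + n * c₄ * b ^ 4 * sampleKurtosis y := by
  have e : ∀ z : ℝ, c₀ + c₁ * (a + b * z) + c₂ * (a + b * z) ^ 2 + c₃ * (a + b * z) ^ 3 +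
      c₄ * (a + b * z) ^ 4 =
      (c₀ + c₁ * a + c₂ * a ^ 2 + c₃ * a ^ 3 + c₄ * a ^ 4) +
      (b * (c₁ + 2 * c₂ * a + 3 * c₃ * a ^ 2 + 4 * c₄ * a ^ 3)) * z +
      (b ^ 2 * (c₂ + 3 * c₃ * a + 6 * c₄ * a ^ 2)) * z ^ 2 +
      (b ^ 3 * (c₃ + 4 * c₄ * a)) * z ^ 3 + (c₄ * b ^ 4) * z ^ 4 := fun z => by ring
  simp only [e, Finset.sum_add_distrib, ← Finset.mul_sum, sum_standardize hn,
    sum_standardize_sq hn hy.ne', sum_standardize_pow hn, Finset.sum_const,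
    Finset.card_univ, Fintype.card_fin, nsmul_eq_mul, sampleSkewness, sampleKurtosis]
  ring

theorem integrable_orbitDensity_quartic {n : ℕ} (hn : n ≠ 0) (k : ℕ) (c₀ c₁ c₂ c₃ c₄ : ℝ) :
    Integrable (fun t : ℝ × ℝ => orbitDensity n t.2 t.1 * t.1 ^ k *
      (n * (c₀ + c₁ * t.2 + c₂ * t.2 ^ 2 + c₃ * t.2 ^ 3 + c₄ * t.2 ^ 4 +
      t.1 ^ 2 * (c₂ + 3 * c₃ * t.2 + 6 * c₄ * t.2 ^ 2)))) orbitMeasure := by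
  have M := integrable_orbitDensity_monomial hn k
  have := (((((((M 0 0).const_mul (n * c₀)).add ((M 1 0).const_mul (n * c₁))).add
    ((M 2 0).const_mul (n * c₂))).add ((M 3 0).const_mul (n * c₃))).add
    ((M 4 0).const_mul (n * c₄))).add ((M 0 2).const_mul (n * c₂))).add
    (((M 1 2).const_mul (n * (3 * c₃))).add ((M 2 2).const_mul (n * (6 * c₄))))
  refine this.congr (.of_forall fun t => ?_)
  simp only [Pi.add_apply]
  ring

namespace IsShapeFamily

variable {f : ℝ → ℝ → ℝ} {n : ℕ}

/-- The sign `σ = ±1` treats both signs of `c₃` at once, since `c₃` times the skewness equals `σ c₃`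
times the signed skewness. -/
theorem lbiTestGivenBy_skewness (hf : IsShapeFamily f) (hn : 2 ≤ n)
    (hreg : RegularityCondition f n) {c₀ c₁ c₂ c₃ : ℝ}
    (hp : ∀ x, scoreAtNormal f x = c₀ + c₁ * x + c₂ * x ^ 2 + c₃ * x ^ 3) {σ : ℝ} (hσ : σ * σ = 1)
    (hc : 0 < σ * c₃) :
    LBITestGivenBy f (fun x : Fin n → ℝ => σ * sampleSkewness x) := by
  have hn0 : n ≠ 0 := by omega
  have hm := measurable_sampleSkewness (n := n)
  have hbd : ∀ x : Fin n → ℝ, |σ * sampleSkewness x| ≤ |σ| * √n ^ 3 := fun x => by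
    rw [abs_mul]
    exact mul_le_mul_of_nonneg_left (abs_centralMoment_div_le hn0 3 x) (abs_nonneg σ)
  have hh := (integrable_orbitDensity_monomial hn0 (n - 2) 0 3).const_mul (n * (σ * c₃))
  refine hf.lbiTestGivenBy_of_slope (hm.const_mul σ) hbd (fun a b hb x => ?_) ?_ fun φ hφ =>
    hf.tendsto_testPower_slope_of_sum_eq hn hreg (hm.const_mul σ) measurable_const hbd
      (S' := fun _ => 0) (C' := 0) (by simp) (integrable_orbitDensity_quartic hn0 _ c₀ c₁ c₂ c₃ 0)
      (h := fun t => n * (σ * c₃) * t.1 ^ 3) (o := fun _ => 0) (hh.congr (.of_forall fun t => ?_))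
      (by simp) (by simp) (fun y hy t => ?_) hφ
  · simp only [sampleSkewness, centralMoment_div_affine hn0 3 a hb]
  · have h1 := integral_orbitDensity_pow_pos hn0 (n - 2) 3
    have h2 : (fun t : ℝ × ℝ => orbitDensity n t.2 t.1 * t.1 ^ (n - 2) *
        (n * (σ * c₃) * t.1 ^ 3)) = fun t => (n * (σ * c₃)) *
        (orbitDensity n t.2 t.1 * t.1 ^ (n - 2) * t.1 ^ 3) := by ext t; ring
    rw [h2, integral_const_mul]
    have h3 := ENNReal.toReal_pos (orbitConst_ne_zero hn) (orbitConst_ne_top hn)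
    positivity
  · simp only [pow_zero, one_mul]; ring
  · have h1 := sum_quartic_standardize hn0 hy c₀ c₁ c₂ c₃ 0 t.2 t.1
    simp only [zero_mul, add_zero] at h1
    simp only [hp, orbitPoint, h1]
    linear_combination (-(n * c₃ * t.1 ^ 3 * sampleSkewness y)) * hσ

/-- The skewness is the nuisance statistic: without odd terms its weight is a multiple of `a * b ^
3`, which integrates to zero by symmetry in `a`. -/
theorem lbiTestGivenBy_kurtosis (hf : IsShapeFamily f) (hn : 2 ≤ n)
    (hreg : RegularityCondition f n) {c₀ c₂ c₄ : ℝ}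
    (hp : ∀ x, scoreAtNormal f x = c₀ + c₂ * x ^ 2 + c₄ * x ^ 4) {σ : ℝ} (hσ : σ * σ = 1)
    (hc : 0 < σ * c₄) :
    LBITestGivenBy f (fun x : Fin n → ℝ => σ * sampleKurtosis x) := by
  have hn0 : n ≠ 0 := by omega
  have hm := measurable_sampleKurtosis (n := n)
  have hbd : ∀ x : Fin n → ℝ, |σ * sampleKurtosis x| ≤ |σ| * √n ^ 4 := fun x => by
    rw [abs_mul]
    exact mul_le_mul_of_nonneg_left (abs_centralMoment_div_le hn0 4 x) (abs_nonneg σ)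
  have hh := (integrable_orbitDensity_monomial hn0 (n - 2) 0 4).const_mul (n * (σ * c₄))
  have ho := (integrable_orbitDensity_monomial hn0 (n - 2) 1 3).const_mul (n * (4 * c₄))
  refine hf.lbiTestGivenBy_of_slope (hm.const_mul σ) hbd (fun a b hb x => ?_) ?_ fun φ hφ =>
    hf.tendsto_testPower_slope_of_sum_eq hn hreg (hm.const_mul σ)
      (measurable_sampleSkewness (n := n)) hbd (abs_centralMoment_div_le hn0 3)
      (integrable_orbitDensity_quartic hn0 _ c₀ 0 c₂ 0 c₄)
      (h := fun t => n * (σ * c₄) * t.1 ^ 4) (o := fun t => n * (4 * c₄) * (t.2 * t.1 ^ 3))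
      (hh.congr (.of_forall fun t => ?_)) (ho.congr (.of_forall fun t => ?_)) ?_
      (fun y hy t => ?_) hφ
  · simp only [sampleKurtosis, centralMoment_div_affine hn0 4 a hb]
  · have h1 := integral_orbitDensity_pow_pos hn0 (n - 2) 4
    have h2 : (fun t : ℝ × ℝ => orbitDensity n t.2 t.1 * t.1 ^ (n - 2) *
        (n * (σ * c₄) * t.1 ^ 4)) = fun t => (n * (σ * c₄)) *
        (orbitDensity n t.2 t.1 * t.1 ^ (n - 2) * t.1 ^ 4) := by ext t; ring
    rw [h2, integral_const_mul]
    have h3 := ENNReal.toReal_pos (orbitConst_ne_zero hn) (orbitConst_ne_top hn)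
    positivity
  · simp only [pow_zero, one_mul]; ring
  · simp only [pow_one]; ring
  · have h2 : (fun t : ℝ × ℝ => orbitDensity n t.2 t.1 * t.1 ^ (n - 2) *
        (n * (4 * c₄) * (t.2 * t.1 ^ 3))) = fun t => (n * (4 * c₄)) *
        (orbitDensity n t.2 t.1 * t.1 ^ (n - 2) * (t.2 * t.1 ^ 3)) := by ext t; ring
    rw [h2, integral_const_mul, integral_orbitDensity_odd, mul_zero]
  · have h1 := sum_quartic_standardize hn0 hy c₀ 0 c₂ 0 c₄ t.2 t.1
    simp only [zero_mul, add_zero] at h1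
    simp only [hp, orbitPoint, h1]
    linear_combination (-(n * c₄ * t.1 ^ 4 * sampleKurtosis y)) * hσ

end IsShapeFamily

theorem corollary1 (f : ℝ → ℝ → ℝ) (n : ℕ) (hn : 2 ≤ n)
    (hf : IsShapeFamily f) (hreg : RegularityCondition f n)
    (p : Polynomial ℝ) (hp : ∀ x : ℝ, scoreAtNormal f x = p.eval x) :
    (p.natDegree = 3 →
      (0 < p.leadingCoeff →
        LBITestGivenBy f (fun x : Fin n → ℝ => sampleSkewness x) ∧
        (3 ≤ n → HasAllCriticalValues f (fun x : Fin n → ℝ => sampleSkewness x))) ∧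
      (p.leadingCoeff < 0 →
        LBITestGivenBy f (fun x : Fin n → ℝ => -sampleSkewness x) ∧
        (3 ≤ n → HasAllCriticalValues f (fun x : Fin n → ℝ => -sampleSkewness x)))) ∧
    (p.natDegree = 4 → p.coeff 1 = 0 → p.coeff 3 = 0 →
      (0 < p.leadingCoeff →
        LBITestGivenBy f (fun x : Fin n → ℝ => sampleKurtosis x) ∧
        (4 ≤ n → HasAllCriticalValues f (fun x : Fin n → ℝ => sampleKurtosis x))) ∧
      (p.leadingCoeff < 0 →
        LBITestGivenBy f (fun x : Fin n → ℝ => -sampleKurtosis x) ∧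
        (4 ≤ n → HasAllCriticalValues f (fun x : Fin n → ℝ => -sampleKurtosis x)))) := by
  refine ⟨fun hdeg => ?_, fun hdeg h1 h3 => ?_⟩
  · have hp' : ∀ x, scoreAtNormal f x =
        p.coeff 0 + p.coeff 1 * x + p.coeff 2 * x ^ 2 + p.coeff 3 * x ^ 3 := fun x => by
      rw [hp, Polynomial.eval_eq_sum_range, hdeg]
      simp [Finset.sum_range_succ]
    rw [Polynomial.leadingCoeff, hdeg]
    refine ⟨fun hc => ⟨?_, fun hn3 => ?_⟩, fun hc => ⟨?_, fun hn3 => ?_⟩⟩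
    · simpa using hf.lbiTestGivenBy_skewness hn hreg hp' (σ := 1) (by norm_num) (by simpa using hc)
    · exact hf.hasAllCriticalValues measurable_sampleSkewness (volume_sampleSkewness_eq hn3)
    · simpa using
        hf.lbiTestGivenBy_skewness hn hreg hp' (σ := -1) (by norm_num) (by simpa using hc)
    · refine hf.hasAllCriticalValues measurable_sampleSkewness.neg fun k => ?_
      simpa only [neg_eq_iff_eq_neg] using volume_sampleSkewness_eq hn3 (-k)
  · have hp' : ∀ x, scoreAtNormal f x =
        p.coeff 0 + p.coeff 2 * x ^ 2 + p.coeff 4 * x ^ 4 := fun x => by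
      rw [hp, Polynomial.eval_eq_sum_range, hdeg]
      simp [Finset.sum_range_succ, h1, h3]
    rw [Polynomial.leadingCoeff, hdeg]
    refine ⟨fun hc => ⟨?_, fun hn4 => ?_⟩, fun hc => ⟨?_, fun hn4 => ?_⟩⟩
    · simpa using hf.lbiTestGivenBy_kurtosis hn hreg hp' (σ := 1) (by norm_num) (by simpa using hc)
    · exact hf.hasAllCriticalValues measurable_sampleKurtosis (volume_sampleKurtosis_eq hn4)
    · simpa using
        hf.lbiTestGivenBy_kurtosis hn hreg hp' (σ := -1) (by norm_num) (by simpa using hc)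
    · refine hf.hasAllCriticalValues measurable_sampleKurtosis.neg fun k => ?_
      simpa only [neg_eq_iff_eq_neg] using volume_sampleKurtosis_eq hn4 (-k)
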